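/- Let $G=(N,E,w)$ be a finite undirected graph with edge weights $w:E\to\mathbb{R}_{\ge 0}$. Its matching game $(N,v)$ assigns to each coalition $S\subseteq N$ the maximum weight $v(S)$ of a matching of the subgraph of $G$ induced by $S$. The Shapley value of a player $i\in N$ is $$\varphi_i(N,v)=\frac1{|N|!}\sum_{S\subseteq N\setminus\{i\}}|S|!\,(|N|-|S|-1)!\,\bigl(v(S\cup\{i\})-v(S)\bigr).$$ Call $G$ complete $k$-partite if $N$ can be partitioned into $k$ (possibly empty) parts such that two vertices are adjacent if and only if they lie in different parts, and all edges between the same two parts have the same weight; in particular, every unweighted complete $k$-partite graph (all weights equal to $1$) is included. Then for every constant $k\in\mathbb{N}$ there is a deterministic (multi-stack) Turing machine that, given a complete $k$-partite graph $G$ with rational weights (as its weighted adjacency matrix, with the weights written as pairs of binary numbers in lowest terms; the partition is not given) and a player $i\in N$, outputs natural numbers $p$ and $q\neq 0$ in binary with $\varphi_i(N,v)=p/q$, in time bounded by a polynomial (which may depend on $k$) in the length of the input. -/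

import Mathlib

namespace ShapleyMatching

open scoped NNReal

/-- A cooperative game with player set `N`: its characteristic function on coalitions. -/
abbrev CoopGame (N : Type*) : Type _ := Finset N → ℝ

open Classical in
/-- The raw Shapley value
`κ_i = ∑_{S ⊆ N \ {i}} |S|! (|N| - |S| - 1)! (v (S ∪ {i}) - v S)`. -/
noncomputable def CoopGame.rawShapleyValue {N : Type*} [Fintype N] (v : CoopGame N) (i : N) : ℝ :=
  ∑ S ∈ (Finset.univ.erase i).powerset,
    (S.card.factorial : ℝ) * ((Fintype.card N - S.card - 1).factorial : ℝ) * (v (insert i S) - v S)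

/-- The Shapley value `φ_i = κ_i / |N|!`. -/
noncomputable def CoopGame.shapleyValue {N : Type*} [Fintype N] (v : CoopGame N) (i : N) : ℝ :=
  CoopGame.rawShapleyValue v i / ((Fintype.card N).factorial : ℝ)

/-- An undirected graph with vertex set `N` and nonnegative real edge weights. -/
structure WeightedGraph (N : Type*) where
  graph : SimpleGraph N
  weight : graph.edgeSet → ℝ≥0

namespace WeightedGraph

variable {N : Type*} (G : WeightedGraph N)

/-- A matching is a set of edges, any two distinct ones of which are disjoint. -/
def IsMatching (M : Finset G.graph.edgeSet) : Prop :=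
  ∀ e ∈ M, ∀ f ∈ M, e ≠ f → ∀ x : N, ¬ (x ∈ (e : Sym2 N) ∧ x ∈ (f : Sym2 N))

/-- All edges of `M` lie in the subgraph induced by `S`. -/
def EdgesWithin (M : Finset G.graph.edgeSet) (S : Finset N) : Prop :=
  ∀ e ∈ M, ∀ x : N, x ∈ (e : Sym2 N) → x ∈ S

open Classical in
/-- The matching game of `G`: the value of a coalition `S` is the maximum weight of a matching of
the subgraph of `G` induced by `S` (the maximum is over a finite set that contains `∅`). -/
noncomputable def matchingGame [Fintype N] : CoopGame N := fun S =>
  (((Finset.univ.filter fun M : Finset G.graph.edgeSet => G.IsMatching M ∧ G.EdgesWithin M S).sup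
    fun M => ∑ e ∈ M, G.weight e : ℝ≥0) : ℝ)

/-- `G` is a complete `k`-partite weighted graph: its vertices can be divided into `k` (possibly
empty) parts such that two vertices are adjacent exactly if they lie in different parts, and all
edges between the same two parts have the same weight (so that each part is a coclique module).
Constant weight `1` is the unweighted case. -/
def IsCompleteKPartite (k : ℕ) : Prop :=
  ∃ part : N → Fin k,
    (∀ x y, G.graph.Adj x y ↔ part x ≠ part y) ∧
    ∀ (x y x' y' : N) (h : G.graph.Adj x y) (h' : G.graph.Adj x' y'),
      part x = part x' → part y = part y' →
        G.weight ⟨s(x, y), (SimpleGraph.mem_edgeSet G.graph).2 h⟩ =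
          G.weight ⟨s(x', y'), (SimpleGraph.mem_edgeSet G.graph).2 h'⟩

end WeightedGraph

/-- An instance of the problem of computing the Shapley value of a player in a matching game:
a graph on the vertices `0, …, n - 1` with nonnegative rational edge weights, and a player. -/
structure Instance where
  n : ℕ
  graph : SimpleGraph (Fin n)
  weight : graph.edgeSet → ℚ≥0
  player : Fin n

namespace Instance

/-- The weighted graph of an instance. -/
noncomputable def toWeightedGraph (I : Instance) : WeightedGraph (Fin I.n) where
  graph := I.graph
  weight e := ((I.weight e : ℚ≥0) : ℝ≥0)

end Instance

/-- The instances whose weighted graph is complete `k`-partite. The partition is not part of the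
instance. -/
abbrev KPartiteInstance (k : ℕ) : Type :=
  {I : Instance // I.toWeightedGraph.IsCompleteKPartite k}

open Computability (Γ')

/-- Natural numbers in binary. -/
def encodeNat (m : ℕ) : List Γ' := (Computability.encodeNat m).map Γ'.bit

open Classical in
/-- An entry of the weighted adjacency matrix: `blank` for a non-edge, and `[p,q]` (numerator and
denominator in binary) for an edge of weight `p / q`. -/
noncomputable def encodeEntry (I : Instance) (x y : Fin I.n) : List Γ' :=
  if h : I.graph.Adj x y then
    let w := I.weight ⟨s(x, y), (SimpleGraph.mem_edgeSet I.graph).2 h⟩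
    [Γ'.bra] ++ encodeNat w.num ++ [Γ'.comma] ++ encodeNat w.den ++ [Γ'.ket]
  else [Γ'.blank]

/-- An instance is written as the player in binary and the rows of the weighted adjacency matrix,
each of these items being followed by a comma. -/
noncomputable def encodeInstance (I : Instance) : List Γ' :=
  encodeNat I.player ++ [Γ'.comma] ++
    (List.finRange I.n).flatMap fun x =>
      ((List.finRange I.n).flatMap fun y => encodeEntry I x y) ++ [Γ'.comma]

/-- A fraction is written as its numerator and its denominator in binary. -/
def encodeFraction (r : ℕ × ℕ) : List Γ' :=
  encodeNat r.1 ++ [Γ'.comma] ++ encodeNat r.2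

end ShapleyMatching

namespace ShapleyMatching

open Computability (Γ')
open Turing

/-! The worth of a coalition depends only on how many members it has in each of the `k` classes. A
matching inside it yields a matrix `x i j` of numbers of edges between classes that respects these
counts. Conversely, every such matrix comes from a matching of the same weight, since vertices of a
class are interchangeable and diagonal entries carry weight zero (`IsScaled.exists_feasible`,
`IsScaled.exists_matching`). So the worth is the optimum of an integer program with `k * k`
variables, each at most `n`, and for fixed `k` it can be found by enumeration. The coalitions with
given class counts number a product of binomial coefficients, which collapses the exponential
Shapley sum to at most `n ^ k` terms (`IsScaled.rawShapleyValue_mul`).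

The computation stays in the natural numbers. Weights are multiplied by the product of all
denominators. Binomial coefficients are avoided through C(a,s) · a! = (a!/s!) · (a!/(a-s)!)
(`fall_mul_fall`), where both quotients are plain products. The surplus factors a! go into the
denominator of the answer. The unknown partition is recovered by numbering the classes in the order
of their least vertices (`classIndex_eq_iff`).

For the machine model, structured programs on six stacks are compiled to Turing machines
(`Cmd.steps_of_run`). Data are binary trees in Polish notation. The predicate `PolyTime` is closed
under composition, pairing, branching, and folds whose intermediate results stay polynomially small
(`PolyTime.foldl_aux`). Binary arithmetic, sums and maxima over ranges, and a constant number of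
nested loops follow from these, and the explicit formula for the Shapley value is assembled from
them. -/

/-- The contents of the six stacks of the machines used here. -/
abbrev Store : Type := Fin 6 → List Γ'

/-! ### Structured stack programs and their compilation to Turing machines -/

/-- Structured programs on six stacks. -/
inductive Cmd : Type
  | push (k : Fin 6) (a : Γ')
  | pop (k : Fin 6)
  | cases (k : Fin 6) (body : Option Γ' → Cmd)
  | loop (k : Fin 6) (p : Option Γ' → Bool) (c : Cmd)
  | seq (c d : Cmd)

/-- Timed big-step semantics: `Run c S t S'` says that `c` leads from `S` to `S'` in `t` steps. -/
inductive Run : Cmd → Store → ℕ → Store → Prop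
  | push (k a S) : Run (.push k a) S 1 (Function.update S k (a :: S k))
  | pop (k S) : Run (.pop k) S 1 (Function.update S k (S k).tail)
  | cases {k body S t S'} (h : Run (body (S k).head?) S t S') :
      Run (.cases k body) S (t + 1) S'
  | loop_done {k p c S} (h : p (S k).head? = false) : Run (.loop k p c) S 1 S
  | loop_step {k p c S t S' t' S''} (h : p (S k).head? = true) (h1 : Run c S t S')
      (h2 : Run (.loop k p c) S' t' S'') : Run (.loop k p c) S (t + t' + 1) S''
  | seq {c d S t S' t' S''} (h1 : Run c S t S') (h2 : Run d S' t' S'') :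
      Run (.seq c d) S (t + t') S''

namespace Cmd

/-- The labels of the machine fragment of a command. -/
def Lab : Cmd → Type
  | push _ _ => Unit
  | pop _ => Unit
  | cases _ body => Option (Σ o : Option Γ', (body o).Lab)
  | loop _ _ c => Option c.Lab
  | seq c d => c.Lab ⊕ d.Lab

/-- The label at which the fragment is entered. -/
def entry : (c : Cmd) → c.Lab
  | push _ _ => ()
  | pop _ => ()
  | cases _ _ => (none : Option _)
  | loop _ _ _ => (none : Option _)
  | seq c _ => Sum.inl c.entry

noncomputable instance fintypeLab : (c : Cmd) → Fintype c.Lab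
  | push _ _ => inferInstanceAs (Fintype Unit)
  | pop _ => inferInstanceAs (Fintype Unit)
  | cases _ body =>
    haveI := fun o => fintypeLab (body o)
    inferInstanceAs (Fintype (Option (Σ o : Option Γ', (body o).Lab)))
  | loop _ _ c =>
    haveI := fintypeLab c
    inferInstanceAs (Fintype (Option c.Lab))
  | seq c d =>
    haveI := fintypeLab c
    haveI := fintypeLab d
    inferInstanceAs (Fintype (c.Lab ⊕ d.Lab))

/-- Machine statements with six stacks over `Γ'`; the state remembers the last symbol read. -/
abbrev MStmt (Λ : Type) : Type := TM2.Stmt (fun _ : Fin 6 => Γ') Λ (Option Γ')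

/-- The machine fragment of a command, with its labels embedded into `Λ` and an exit label. -/
def code {Λ : Type} : (c : Cmd) → (c.Lab → Λ) → Λ → c.Lab → MStmt Λ
  | push k a, _, ex, _ => .push k (fun _ => a) (.goto fun _ => ex)
  | pop k, _, ex, _ => .pop k (fun v _ => v) (.goto fun _ => ex)
  | cases k body, emb, _, none =>
    .peek k (fun _ o => o) (.goto fun o => emb (some ⟨o, (body o).entry⟩))
  | cases _ body, emb, ex, some ⟨o, l⟩ => (body o).code (fun l => emb (some ⟨o, l⟩)) ex l
  | loop k p c, emb, ex, none =>
    .peek k (fun _ o => o) (.goto fun o => bif p o then emb (some c.entry) else ex)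
  | loop _ _ c, emb, _, some l => c.code (fun l => emb (some l)) (emb none) l
  | seq c d, emb, _, Sum.inl l => c.code (fun l => emb (.inl l)) (emb (.inr d.entry)) l
  | seq _ d, emb, ex, Sum.inr l => d.code (fun l => emb (.inr l)) ex l

/-- Reachability in exactly `t` steps. -/
def Steps {Λ : Type} (M : Λ → MStmt Λ) (t : ℕ)
    (x y : TM2.Cfg (fun _ : Fin 6 => Γ') Λ (Option Γ')) : Prop :=
  (flip bind (TM2.step M))^[t] (some x) = some y

theorem Steps.trans {Λ : Type} {M : Λ → MStmt Λ} {s t : ℕ}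
    {x y z : TM2.Cfg (fun _ : Fin 6 => Γ') Λ (Option Γ')}
    (h1 : Steps M s x y) (h2 : Steps M t y z) : Steps M (s + t) x z := by
  unfold Steps at *
  rw [Nat.add_comm, Function.iterate_add_apply, h1, h2]

theorem Steps.one {Λ : Type} {M : Λ → MStmt Λ}
    {x y : TM2.Cfg (fun _ : Fin 6 => Γ') Λ (Option Γ')}
    (h : TM2.step M x = some y) : Steps M 1 x y := h

/-- Each constructor of `Run` is matched by the corresponding piece of `code`. The exit label and
the label embedding vary in the induction because a subprogram sits in a larger machine and may
return into a loop head. The internal state is arbitrary on entry, because every branch reads its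
symbol afresh. -/
theorem steps_of_run {Λ : Type} (M : Λ → MStmt Λ) {c : Cmd} {S S' : Store} {t : ℕ}
    (h : Run c S t S') (emb : c.Lab → Λ) (ex : Λ) (hM : ∀ l, M (emb l) = c.code emb ex l)
    (v : Option Γ') :
    ∃ v', Steps M t ⟨some (emb c.entry), v, S⟩ ⟨some ex, v', S'⟩ := by
  induction h generalizing ex v with
  | push k a S =>
    refine ⟨v, Steps.one ?_⟩
    rw [TM2.step, hM]; rfl
  | pop k S =>
    refine ⟨v, Steps.one ?_⟩
    rw [TM2.step, hM]; rfl
  | @cases k body S t S' h ih =>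
    obtain ⟨v', hv⟩ := ih (fun l => emb (some ⟨_, l⟩)) ex (fun l => hM (some ⟨_, l⟩)) (S k).head?
    refine ⟨v', ?_⟩
    rw [Nat.add_comm]
    refine Steps.trans (Steps.one ?_) hv
    rw [TM2.step, hM]; rfl
  | @loop_done k p c S h =>
    refine ⟨(S k).head?, Steps.one ?_⟩
    rw [TM2.step, hM]
    simp [entry, code, TM2.stepAux, h]
  | @loop_step k p c S t S' t' S'' h h1 h2 ih1 ih2 =>
    obtain ⟨v1, hv1⟩ := ih1 (fun l => emb (some l)) (emb none) (fun l => hM (some l)) (S k).head?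
    obtain ⟨v2, hv2⟩ := ih2 emb ex hM v1
    refine ⟨v2, ?_⟩
    rw [Nat.add_comm]
    refine Steps.trans (Steps.one ?_) (hv1.trans hv2)
    rw [TM2.step, hM]
    simp [entry, code, TM2.stepAux, h]
  | @seq c d S t S' t' S'' h1 h2 ih1 ih2 =>
    obtain ⟨v1, hv1⟩ := ih1 (fun l => emb (.inl l)) _ (fun l => hM (.inl l)) v
    obtain ⟨v2, hv2⟩ := ih2 (fun l => emb (.inr l)) ex (fun l => hM (.inr l)) v1
    exact ⟨v2, hv1.trans hv2⟩

/-- The machine of a command; input and output are on stack `0`. -/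
noncomputable def machine (c : Cmd) : FinTM2 where
  K := Fin 6
  k₀ := 0
  k₁ := 0
  Γ _ := Γ'
  Λ := Option c.Lab
  main := some c.entry
  σ := Option Γ'
  initialState := none
  m
    | none => .load (fun _ => none) .halt
    | some l => c.code some none l

end Cmd

/-! ### Explicit stores, and machines obtained from programs -/

/-- The store with the given stacks. -/
def st (inp main lst aux tmp cnt : List Γ') : Store := ![inp, main, lst, aux, tmp, cnt]

section

variable (a b c d e f v : List Γ')

@[simp] theorem st_apply_zero : st a b c d e f 0 = a := rfl
@[simp] theorem st_apply_one : st a b c d e f 1 = b := rfl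
@[simp] theorem st_apply_two : st a b c d e f 2 = c := rfl
@[simp] theorem st_apply_three : st a b c d e f 3 = d := rfl
@[simp] theorem st_apply_four : st a b c d e f 4 = e := rfl
@[simp] theorem st_apply_five : st a b c d e f 5 = f := rfl
@[simp] theorem update_st_zero : Function.update (st a b c d e f) 0 v = st v b c d e f := by
  funext k; fin_cases k <;> rfl
@[simp] theorem update_st_one : Function.update (st a b c d e f) 1 v = st a v c d e f := by
  funext k; fin_cases k <;> rfl
@[simp] theorem update_st_two : Function.update (st a b c d e f) 2 v = st a b v d e f := by
  funext k; fin_cases k <;> rfl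
@[simp] theorem update_st_three : Function.update (st a b c d e f) 3 v = st a b c v e f := by
  funext k; fin_cases k <;> rfl
@[simp] theorem update_st_four : Function.update (st a b c d e f) 4 v = st a b c d v f := by
  funext k; fin_cases k <;> rfl
@[simp] theorem update_st_five : Function.update (st a b c d e f) 5 v = st a b c d e v := by
  funext k; fin_cases k <;> rfl

end

/-- A program that computes `f` on the input stack within a polynomial time bound yields a
polynomial-time machine. -/
theorem nonempty_computableInPolyTime {α β : Type} {ea : α → List Γ'} {eb : β → List Γ'}
    {f : α → β} (c : Cmd) (p : Polynomial ℕ)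
    (h : ∀ a, ∃ t ≤ p.eval (ea a).length,
      Run c (st (ea a) [] [] [] [] []) t (st (eb (f a)) [] [] [] [] [])) :
    Nonempty (TM2ComputableInPolyTime ea eb f) := by
  refine ⟨⟨⟨c.machine, Equiv.refl _, Equiv.refl _⟩, p + 1, fun a => ?_⟩⟩
  have h' : ∃ t, t ≤ (p + 1).eval (ea a).length ∧
      (flip bind c.machine.step)^[t] (some (initList c.machine (ea a))) =
        some (haltList c.machine (eb (f a))) := by
    obtain ⟨t, ht, hr⟩ := h a
    obtain ⟨v, hv⟩ := Cmd.steps_of_run c.machine.m hr some none (fun _ => rfl) none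
    -- The extra step is the exit label, which resets the internal state before halting as
    -- `haltList` demands.
    refine ⟨t + 1, by simpa using ht, ?_⟩
    have e1 : initList c.machine (ea a) =
        ⟨some (some c.entry), none, st (ea a) [] [] [] [] []⟩ := by
      unfold initList
      congr 1
      funext k
      change Fin 6 at k
      fin_cases k <;> rfl
    have e2 : haltList c.machine (eb (f a)) = ⟨none, none, st (eb (f a)) [] [] [] [] []⟩ := by
      unfold haltList
      congr 1
      funext k
      change Fin 6 at k
      fin_cases k <;> rfl
    rw [e1, e2]
    exact hv.trans (Cmd.Steps.one rfl)
  refine ⟨⟨Classical.choose h', ?_⟩, (Classical.choose_spec h').1⟩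
  convert (Classical.choose_spec h').2 using 3
  · exact congrArg _ (List.map_id _)
  · exact congrArg (fun l => some (haltList c.machine l)) (List.map_id _)

/-! ### Runs with an upper bound on the time -/

/-- `RunLe c S t S'`: the program `c` leads from `S` to `S'` in at most `t` steps. -/
def RunLe (c : Cmd) (S : Store) (t : ℕ) (S' : Store) : Prop := ∃ t' ≤ t, Run c S t' S'

theorem RunLe.mono {c : Cmd} {S S' : Store} {t t' : ℕ} (h : RunLe c S t S') (ht : t ≤ t') :
    RunLe c S t' S' :=
  let ⟨s, hs, hr⟩ := h
  ⟨s, hs.trans ht, hr⟩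

theorem RunLe.congr {c : Cmd} {S S' S'' : Store} {t : ℕ} (h : RunLe c S t S') (e : S' = S'') :
    RunLe c S t S'' := e ▸ h

theorem RunLe.congr_left {c : Cmd} {S S₁ S' : Store} {t : ℕ} (h : RunLe c S t S') (e : S₁ = S) :
    RunLe c S₁ t S' := e ▸ h

theorem RunLe.seq {c d : Cmd} {S S' S'' : Store} {t t' : ℕ} (h1 : RunLe c S t S')
    (h2 : RunLe d S' t' S'') : RunLe (.seq c d) S (t + t') S'' :=
  let ⟨_, hs, hr⟩ := h1
  let ⟨_, hs', hr'⟩ := h2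
  ⟨_, Nat.add_le_add hs hs', Run.seq hr hr'⟩

theorem RunLe.push (k : Fin 6) (a : Γ') (S : Store) :
    RunLe (.push k a) S 1 (Function.update S k (a :: S k)) := ⟨1, le_rfl, Run.push k a S⟩

theorem RunLe.pop (k : Fin 6) (S : Store) :
    RunLe (.pop k) S 1 (Function.update S k (S k).tail) := ⟨1, le_rfl, Run.pop k S⟩

theorem RunLe.cases {k : Fin 6} {body : Option Γ' → Cmd} {S S' : Store} {t : ℕ}
    (h : RunLe (body (S k).head?) S t S') : RunLe (.cases k body) S (t + 1) S' :=
  let ⟨_, hs, hr⟩ := h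
  ⟨_, Nat.add_le_add_right hs 1, Run.cases hr⟩

theorem RunLe.loop_done {k : Fin 6} {p : Option Γ' → Bool} {c : Cmd} {S : Store}
    (h : p (S k).head? = false) : RunLe (.loop k p c) S 1 S := ⟨1, le_rfl, Run.loop_done h⟩

theorem RunLe.loop_step {k : Fin 6} {p : Option Γ' → Bool} {c : Cmd} {S S' S'' : Store} {t t' : ℕ}
    (h : p (S k).head? = true) (h1 : RunLe c S t S') (h2 : RunLe (.loop k p c) S' t' S'') :
    RunLe (.loop k p c) S (t + t' + 1) S'' :=
  let ⟨_, hs, hr⟩ := h1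
  let ⟨_, hs', hr'⟩ := h2
  ⟨_, by omega, Run.loop_step h hr hr'⟩

/-- One step pushes at most one symbol. This is why a time bound is also a bound on the size of the
output. -/
theorem Run.length_le {c : Cmd} {S S' : Store} {t : ℕ} (h : Run c S t S') (j : Fin 6) :
    (S' j).length ≤ (S j).length + t := by
  induction h with
  | push k a S => by_cases hj : j = k <;> simp [hj]
  | pop k S =>
    by_cases hj : j = k
    · subst hj; simp; omega
    · simp [hj]
  | cases h ih => omega
  | loop_done h => omega
  | loop_step h h1 h2 ih1 ih2 => omega
  | seq h1 h2 ih1 ih2 => omega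

/-! ### Moving stacks -/

/-- Move stack `j` onto stack `k`, reversing the order. -/
def moveAll (j k : Fin 6) : Cmd :=
  .loop j Option.isSome (.cases j fun o => .seq (.pop j) (.push k (o.getD .blank)))

theorem runLe_moveAll {j k : Fin 6} (hjk : j ≠ k) (S : Store) :
    RunLe (moveAll j k) S (4 * (S j).length + 1)
      (Function.update (Function.update S j []) k ((S j).reverse ++ S k)) := by
  generalize hl : S j = l
  induction l generalizing S with
  | nil =>
    refine (RunLe.loop_done (by simp [hl])).congr ?_
    rw [← hl]
    funext x
    by_cases hx : x = k
    · subst hx; simp [hl]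
    · simp [hx]
  | cons a l ih =>
    have h1 := RunLe.cases (k := j) (S := S)
      (body := fun o => .seq (.pop j) (.push k (o.getD .blank)))
      ((RunLe.pop j S).seq (RunLe.push k _ _))
    have h2 := ih (Function.update (Function.update S j (S j).tail) k
      (((S j).head?.getD .blank) :: Function.update S j (S j).tail k)) (by simp [hjk, hl])
    refine ((RunLe.loop_step (by simp [hl]) h1 h2).mono (by simp; omega)).congr ?_
    funext x
    by_cases hx : x = k
    · subst hx; simp [hjk.symm, hl]
    · by_cases hx' : x = j
      · subst hx'; simp [hx]
      · simp [hx, hx']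

/-- Move stack `j` onto both stacks `k` and `l`, reversing the order. -/
def moveAll₂ (j k l : Fin 6) : Cmd :=
  .loop j Option.isSome
    (.cases j fun o => .seq (.pop j) (.seq (.push k (o.getD .blank)) (.push l (o.getD .blank))))

theorem runLe_moveAll₂ {j k l : Fin 6} (hjk : j ≠ k) (hjl : j ≠ l) (hkl : k ≠ l) (S : Store) :
    RunLe (moveAll₂ j k l) S (5 * (S j).length + 1)
      (Function.update (Function.update (Function.update S j []) k ((S j).reverse ++ S k)) l
        ((S j).reverse ++ S l)) := by
  generalize hm : S j = m
  induction m generalizing S with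
  | nil =>
    refine (RunLe.loop_done (by simp [hm])).congr ?_
    rw [← hm]
    funext x
    by_cases hx : x = l
    · subst hx; simp [hm]
    · by_cases hx' : x = k
      · subst hx'; simp [hx, hm]
      · simp [hx, hx']
  | cons a m ih =>
    have h1 := RunLe.cases (k := j) (S := S)
      (body := fun o => .seq (.pop j) (.seq (.push k (o.getD .blank)) (.push l (o.getD .blank))))
      ((RunLe.pop j S).seq ((RunLe.push k _ _).seq (RunLe.push l _ _)))
    refine ((RunLe.loop_step (by simp [hm]) h1 (ih _ (by simp [hjk, hjl, hm]))).mono (by simp; omega)).congr ?_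
    funext x
    by_cases hx : x = l
    · subst hx; simp [hjl.symm, hkl.symm, hm]
    · by_cases hx' : x = k
      · subst hx'; simp [hjk.symm, hx, hm]
      · by_cases hx'' : x = j
        · subst hx''; simp [hx, hx']
        · simp [hx, hx', hx'']

/-- Empty stack `j`. -/
def clear (j : Fin 6) : Cmd := .loop j Option.isSome (.pop j)

theorem runLe_clear (j : Fin 6) (S : Store) :
    RunLe (clear j) S (2 * (S j).length + 1) (Function.update S j []) := by
  generalize hl : S j = l
  induction l generalizing S with
  | nil => exact (RunLe.loop_done (by simp [hl])).congr (by rw [← hl]; simp)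
  | cons a l ih =>
    have h2 := ih (Function.update S j (S j).tail) (by simp [hl])
    exact ((RunLe.loop_step (by simp [hl]) (RunLe.pop j S) h2).mono (by simp; omega)).congr
      (by simp)

/-! ### Binary trees as data -/

/-- Binary trees, the universal data type. -/
inductive BTree : Type
  | nil
  | node (a b : BTree)

namespace BTree

/-- The number of nodes and leaves. -/
def size : BTree → ℕ
  | nil => 1
  | node a b => 1 + a.size + b.size

/-- Polish notation of a tree. -/
def ser : BTree → List Γ'
  | nil => [.bit false]
  | node a b => .bit true :: (a.ser ++ b.ser)

@[simp] theorem length_ser (x : BTree) : x.ser.length = x.size := by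
  induction x with
  | nil => rfl
  | node a b iha ihb => simp [ser, size, iha, ihb]; omega

theorem one_le_size (x : BTree) : 1 ≤ x.size := by cases x <;> simp only [size] <;> omega

/-- The left subtree. -/
def left : BTree → BTree
  | nil => nil
  | node a _ => a

/-- The right subtree. -/
def right : BTree → BTree
  | nil => nil
  | node _ b => b

end BTree

open BTree

/-- Whether the symbol read starts an inner node. -/
def isOne : Option Γ' → Bool
  | some (.bit true) => true
  | _ => false

/-- Move symbols from stack `k` to stack `3`, as long as the unary counter on stack `5`, which
holds the number of trees still to be read, is positive. -/
def grabLoop (k : Fin 6) : Cmd :=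
  .loop 5 isOne (.seq (.pop 5) (.cases k fun o => .seq (.pop k)
    (bif isOne o then
      .seq (.push 3 (.bit true)) (.seq (.push 5 (.bit true)) (.push 5 (.bit true)))
    else .push 3 (.bit false))))

/-- Polish notation is self-delimiting: an inner node replaces one pending tree by two, and a leaf
removes one. The rest of the run is a hypothesis, so that for a node the run on the right subtree
can serve as the continuation of the run on the left one. -/
theorem runLe_grabLoop {k : Fin 6} (hk3 : k ≠ 3) (hk5 : k ≠ 5) (x : BTree) (R C : List Γ')
    (S S' : Store) (t : ℕ) (h1 : S k = x.ser ++ R) (h2 : S 5 = .bit true :: C)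
    (h : RunLe (grabLoop k)
      (Function.update (Function.update (Function.update S k R) 3 (x.ser.reverse ++ S 3)) 5 C)
      t S') :
    RunLe (grabLoop k) S (7 * x.size + t) S' := by
  induction x generalizing S C R t with
  | nil =>
    have hc : (Function.update S 5 (S 5).tail k).head? = some (.bit false) := by
      simp [hk5, h1, ser]
    have hb := (RunLe.pop 5 S).seq (RunLe.cases (k := k)
      (body := fun o => .seq (.pop k)
        (bif isOne o then
          .seq (.push 3 (.bit true)) (.seq (.push 5 (.bit true)) (.push 5 (.bit true)))
        else .push 3 (.bit false))) (by
          rw [hc]; exact (RunLe.pop k _).seq (RunLe.push 3 (.bit false) _)))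
    refine (RunLe.loop_step (by simp [h2, isOne]) (hb.congr ?_) h).mono
      (by simp [BTree.size]; try omega)
    funext y
    by_cases hy : y = 5
    · subst hy; simp [hk5.symm, h2]
    · by_cases hy' : y = 3
      · subst hy'; simp [hk3.symm, ser]
      · by_cases hy'' : y = k
        · subst hy''; simp [hk3, hk5, h1, ser]
        · simp [hy, hy', hy'']
  | node a b iha ihb =>
    have hc : (Function.update S 5 (S 5).tail k).head? = some (.bit true) := by
      simp [hk5, h1, ser]
    have hb := (RunLe.pop 5 S).seq (RunLe.cases (k := k)
      (body := fun o => .seq (.pop k)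
        (bif isOne o then
          .seq (.push 3 (.bit true)) (.seq (.push 5 (.bit true)) (.push 5 (.bit true)))
        else .push 3 (.bit false))) (by
          rw [hc]; exact (RunLe.pop k _).seq ((RunLe.push 3 (.bit true) _).seq
            ((RunLe.push 5 (.bit true) _).seq (RunLe.push 5 (.bit true) _)))))
    have hab := iha (b.ser ++ R) (.bit true :: C)
      (Function.update (Function.update (Function.update S k (a.ser ++ (b.ser ++ R))) 3
        (.bit true :: S 3)) 5 (.bit true :: .bit true :: C)) _ (by simp [hk3, hk5]) (by simp)
      (ihb R C _ t (by simp [hk3, hk5]) (by simp) (h.congr_left ?_))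
    · refine (RunLe.loop_step (by simp [h2, isOne]) (hb.congr ?_) hab).mono
        (by simp [BTree.size]; omega)
      funext y
      by_cases hy : y = 5
      · subst hy; simp [hk5.symm, h2]
      · by_cases hy' : y = 3
        · subst hy'; simp [hk3.symm]
        · by_cases hy'' : y = k
          · subst hy''; simp [hk3, hk5, h1, ser]
          · simp [hy, hy', hy'']
    · funext y
      by_cases hy : y = 5
      · subst hy; simp
      · by_cases hy' : y = 3
        · subst hy'; simp [ser]
        · by_cases hy'' : y = k
          · subst hy''; simp [hk3, hk5]
          · simp [hy, hy', hy'']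

/-- Move the tree on top of stack `k` to stack `3`, reversed. -/
def grab (k : Fin 6) : Cmd := .seq (.push 5 (.bit true)) (grabLoop k)

theorem runLe_grab {k : Fin 6} (hk3 : k ≠ 3) (hk5 : k ≠ 5) (x : BTree) (R : List Γ')
    (S : Store) (h1 : S k = x.ser ++ R) (h2 : S 5 = []) :
    RunLe (grab k) S (7 * x.size + 2)
      (Function.update (Function.update S k R) 3 (x.ser.reverse ++ S 3)) := by
  refine ((RunLe.push 5 _ S).seq (runLe_grabLoop hk3 hk5 x R [] _ _ 1 (by simp [hk5, h1])
    (by simp [h2]) (RunLe.loop_done (by simp [isOne])))).mono (by omega) |>.congr ?_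
  funext y
  by_cases hy : y = 5
  · subst hy; simp [hk5.symm, h2]
  · by_cases hy' : y = 3
    · subst hy'; simp
    · by_cases hy'' : y = k
      · subst hy''; simp [hk3, hk5]
      · simp [hy, hy', hy'']

theorem runLe_grab_one (x : BTree) (i R L A T : List Γ') :
    RunLe (grab 1) (st i (x.ser ++ R) L A T []) (7 * x.size + 2)
      (st i R L (x.ser.reverse ++ A) T []) :=
  (runLe_grab (by decide) (by decide) x R _ rfl rfl).congr (by simp)

theorem runLe_grab_two (x : BTree) (i R L A T : List Γ') :
    RunLe (grab 2) (st i R (x.ser ++ L) A T []) (7 * x.size + 2)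
      (st i R L (x.ser.reverse ++ A) T []) :=
  (runLe_grab (by decide) (by decide) x L _ rfl rfl).congr (by simp)

/-! ### Basic operations on trees -/

/-- `c` replaces the tree `x` on top of the main stack by the tree `y` in at most `t` steps. -/
def Computes (c : Cmd) (x y : BTree) (t : ℕ) : Prop :=
  ∀ i R L, RunLe c (st i (x.ser ++ R) L [] [] []) t (st i (y.ser ++ R) L [] [] [])

theorem Computes.size_le {c : Cmd} {x y : BTree} {t : ℕ} (h : Computes c x y t) :
    y.size ≤ x.size + t := by
  obtain ⟨t', ht, hr⟩ := h [] [] []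
  have := hr.length_le 1
  simp at this
  omega

theorem Computes.seq {c d : Cmd} {x y z : BTree} {s t : ℕ} (h1 : Computes c x y s)
    (h2 : Computes d y z t) : Computes (.seq c d) x z (s + t) :=
  fun i R L => (h1 i R L).seq (h2 i R L)

/-- Duplicate the top tree. -/
def dup : Cmd := .seq (grab 1) (.seq (moveAll₂ 3 1 4) (.seq (moveAll 4 3) (moveAll 3 1)))

theorem runLe_dup (x : BTree) (i R L : List Γ') :
    RunLe dup (st i (x.ser ++ R) L [] [] []) (20 * x.size + 5)
      (st i (x.ser ++ (x.ser ++ R)) L [] [] []) := by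
  have h1 := runLe_grab_one x i R L [] []
  have h2 := runLe_moveAll₂ (j := 3) (k := 1) (l := 4) (by decide) (by decide) (by decide)
    (st i R L (x.ser.reverse ++ []) [] [])
  have h3 := runLe_moveAll (j := 4) (k := 3) (by decide) (st i (x.ser ++ R) L [] x.ser [])
  have h4 := runLe_moveAll (j := 3) (k := 1) (by decide) (st i (x.ser ++ R) L x.ser.reverse [] [])
  simp at h1 h2 h3 h4
  exact (h1.seq (h2.seq (h3.seq h4))).mono (by omega)

/-- Exchange the two top trees. -/
def swap : Cmd := .seq (grab 1) (.seq (moveAll 3 4) (.seq (grab 1) (.seq (moveAll 3 5)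
  (.seq (moveAll 4 3) (.seq (moveAll 3 1) (.seq (moveAll 5 3) (moveAll 3 1)))))))

theorem runLe_swap (x y : BTree) (i R L : List Γ') :
    RunLe swap (st i (x.ser ++ (y.ser ++ R)) L [] [] []) (19 * x.size + 19 * y.size + 10)
      (st i (y.ser ++ (x.ser ++ R)) L [] [] []) := by
  have h1 := runLe_grab_one x i (y.ser ++ R) L [] []
  have h2 := runLe_moveAll (j := 3) (k := 4) (by decide) (st i (y.ser ++ R) L x.ser.reverse [] [])
  have h3 := runLe_grab_one y i R L [] x.ser
  have h4 := runLe_moveAll (j := 3) (k := 5) (by decide) (st i R L y.ser.reverse x.ser [])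
  have h5 := runLe_moveAll (j := 4) (k := 3) (by decide) (st i R L [] x.ser y.ser)
  have h6 := runLe_moveAll (j := 3) (k := 1) (by decide) (st i R L x.ser.reverse [] y.ser)
  have h7 := runLe_moveAll (j := 5) (k := 3) (by decide) (st i (x.ser ++ R) L [] [] y.ser)
  have h8 := runLe_moveAll (j := 3) (k := 1) (by decide) (st i (x.ser ++ R) L y.ser.reverse [] [])
  simp at h1 h2 h3 h4 h5 h6 h7 h8
  exact (h1.seq (h2.seq (h3.seq (h4.seq (h5.seq (h6.seq (h7.seq h8))))))).mono (by omega)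

/-- Remove the top tree. -/
def drop : Cmd := .seq (grab 1) (clear 3)

theorem runLe_drop (x : BTree) (i R L : List Γ') :
    RunLe drop (st i (x.ser ++ R) L [] [] []) (9 * x.size + 3) (st i R L [] [] []) := by
  have h1 := runLe_grab_one x i R L [] []
  have h2 := runLe_clear 3 (st i R L x.ser.reverse [] [])
  simp at h1 h2
  exact (h1.seq h2).mono (by omega)

/-- Push the symbols of a list. -/
def pushList (k : Fin 6) : List Γ' → Cmd
  | [] => .seq (.push k .blank) (.pop k)
  | a :: l => .seq (pushList k l) (.push k a)

theorem runLe_pushList (k : Fin 6) (l : List Γ') (S : Store) :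
    RunLe (pushList k l) S (l.length + 2) (Function.update S k (l ++ S k)) := by
  induction l with
  | nil =>
    exact ((RunLe.push k _ S).seq (RunLe.pop k _)).congr (by simp)
  | cons a l ih =>
    exact ((ih.seq (RunLe.push k a _)).mono (by simp; try omega)).congr (by simp)

theorem runLe_pushList_one (l i R L A T C : List Γ') :
    RunLe (pushList 1 l) (st i R L A T C) (l.length + 2) (st i (l ++ R) L A T C) :=
  (runLe_pushList 1 l _).congr (by simp)

/-! ### Encodings and polynomial bounds -/

/-- Types whose elements are written as binary trees. -/
class Enc (α : Type) where
  /-- The tree of an element. -/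
  enc : α → BTree

open Enc

/-- The size of the encoding. -/
def sz {α : Type} [Enc α] (a : α) : ℕ := (enc a).size

theorem one_le_sz {α : Type} [Enc α] (a : α) : 1 ≤ sz a := BTree.one_le_size _

instance : Enc BTree := ⟨id⟩

instance : Enc Bool := ⟨fun b => bif b then node nil nil else nil⟩

-- Giving propositions the trees of their truth values makes decidable predicates ordinary
-- `PolyTime` functions.
open Classical in
noncomputable instance : Enc Prop := ⟨fun p => if p then node nil nil else nil⟩

instance {α β : Type} [Enc α] [Enc β] : Enc (α × β) := ⟨fun x => node (enc x.1) (enc x.2)⟩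

/-- The tree of a list. -/
def encList {α : Type} [Enc α] : List α → BTree
  | [] => nil
  | a :: l => node (enc a) (encList l)

instance {α : Type} [Enc α] : Enc (List α) := ⟨encList⟩

/-- Since a number and its digit list have the same tree, passing from one to the other costs
nothing. -/
instance : Enc ℕ := ⟨fun n => enc n.bits⟩

section

variable {α β : Type} [Enc α] [Enc β]

@[simp] theorem enc_tree (x : BTree) : enc x = x := rfl
@[simp] theorem enc_true : enc true = node nil nil := rfl
@[simp] theorem enc_false : enc false = nil := rfl
@[simp] theorem enc_pair (a : α) (b : β) : enc (a, b) = node (enc a) (enc b) := rfl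
@[simp] theorem enc_list_nil : enc ([] : List α) = nil := rfl
@[simp] theorem enc_list_cons (a : α) (l : List α) : enc (a :: l) = node (enc a) (enc l) := rfl
theorem enc_nat (n : ℕ) : enc n = enc n.bits := rfl
theorem enc_prop (p : Prop) [Decidable p] : enc p = enc (decide p) := by
  by_cases h : p <;> simp [enc, h]

@[simp] theorem sz_pair (a : α) (b : β) : sz (a, b) = 1 + sz a + sz b := rfl
@[simp] theorem sz_list_nil : sz ([] : List α) = 1 := rfl
@[simp] theorem sz_list_cons (a : α) (l : List α) : sz (a :: l) = 1 + sz a + sz l := rfl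

theorem length_lt_sz (l : List α) : l.length < sz l := by
  induction l with
  | nil => simp
  | cons a l ih => simp; omega

theorem sz_le_of_mem {a : α} {l : List α} (h : a ∈ l) : sz a < sz l := by
  induction l with
  | nil => simp at h
  | cons b l ih =>
    have := one_le_sz l
    have := one_le_sz b
    rcases List.mem_cons.1 h with rfl | h
    · simp; omega
    · have := ih h; simp; omega

/-- The `1` appears because both lists on the right count their terminating leaf. -/
theorem sz_append (l m : List α) : sz (l ++ m) + 1 = sz l + sz m := by
  induction l with
  | nil => simp; omega
  | cons a l ih => simp; omega

theorem sz_reverse (l : List α) : sz l.reverse = sz l := by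
  induction l with
  | nil => rfl
  | cons a l ih =>
    have := sz_append l.reverse [a]
    simp at this ⊢; omega

theorem sz_le_of_forall {l : List α} {B : ℕ} (h : ∀ a ∈ l, sz a ≤ B) :
    sz l ≤ l.length * (B + 1) + 1 := by
  induction l with
  | nil => simp
  | cons a l ih =>
    have h1 := h a (by simp)
    have h2 := ih fun b hb => h b (by simp [hb])
    simp [add_mul]; omega

end

/-- `b` is bounded by a polynomial in the size of the encoding. -/
def PolyBd {α : Type} [Enc α] (b : α → ℕ) : Prop :=
  ∃ p : Polynomial ℕ, ∀ a, b a ≤ p.eval (sz a)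

theorem eval_mono (p : Polynomial ℕ) : Monotone fun n => p.eval n := by
  intro m n h
  induction p using Polynomial.induction_on' with
  | add p q hp hq => simpa using Nat.add_le_add hp hq
  | monomial d c => simpa using Nat.mul_le_mul_left c (Nat.pow_le_pow_left h d)

namespace PolyBd

variable {α β : Type} [Enc α] [Enc β]

theorem mono {b c : α → ℕ} (hc : PolyBd c) (h : ∀ a, b a ≤ c a) : PolyBd b :=
  let ⟨p, hp⟩ := hc
  ⟨p, fun a => (h a).trans (hp a)⟩

theorem const (n : ℕ) : PolyBd fun _ : α => n := ⟨Polynomial.C n, fun a => by simp⟩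

theorem sz : PolyBd fun a : α => ShapleyMatching.sz a := ⟨Polynomial.X, fun a => by simp⟩

theorem add {b c : α → ℕ} (hb : PolyBd b) (hc : PolyBd c) : PolyBd fun a => b a + c a :=
  let ⟨p, hp⟩ := hb
  let ⟨q, hq⟩ := hc
  ⟨p + q, fun a => by simpa using Nat.add_le_add (hp a) (hq a)⟩

theorem mul {b c : α → ℕ} (hb : PolyBd b) (hc : PolyBd c) : PolyBd fun a => b a * c a :=
  let ⟨p, hp⟩ := hb
  let ⟨q, hq⟩ := hc
  ⟨p * q, fun a => by simpa using Nat.mul_le_mul (hp a) (hq a)⟩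

theorem eval {b : α → ℕ} (hb : PolyBd b) (q : Polynomial ℕ) : PolyBd fun a => q.eval (b a) :=
  let ⟨p, hp⟩ := hb
  ⟨q.comp p, fun a => by simpa using eval_mono q (hp a)⟩

theorem comp {f : α → β} {b : β → ℕ} (hb : PolyBd b)
    (hf : PolyBd fun a => ShapleyMatching.sz (f a)) : PolyBd fun a => b (f a) :=
  let ⟨p, hp⟩ := hb
  (hf.eval p).mono fun a => hp (f a)

end PolyBd

/-! ### Polynomial-time functions and their closure properties -/

/-- `f` is computed in polynomial time by a program that works on trees. -/
@[fun_prop]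
def PolyTime {α β : Type} [Enc α] [Enc β] (f : α → β) : Prop :=
  ∃ (c : Cmd) (b : α → ℕ), PolyBd b ∧ ∀ a, Computes c (enc a) (enc (f a)) (b a)

namespace PolyTime

variable {α β γ δ : Type} [Enc α] [Enc β] [Enc γ] [Enc δ]

/-- Output size is at most input size plus running time. Composition needs this, since the second
program is timed against its own input. -/
theorem sz_bd {f : α → β} (hf : PolyTime f) : PolyBd fun a => sz (f a) :=
  let ⟨_, _, hb, h⟩ := hf
  (PolyBd.sz.add hb).mono fun a => (h a).size_le

theorem congr_enc {f : α → β} {g : α → γ} (hf : PolyTime f) (h : ∀ a, enc (g a) = enc (f a)) :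
    PolyTime g :=
  let ⟨c, b, hb, hc⟩ := hf
  ⟨c, b, hb, fun a => by rw [h]; exact hc a⟩

theorem of_enc_eq {f : α → β} (h : ∀ a, enc (f a) = enc a) : PolyTime f :=
  ⟨.seq (.push 1 .blank) (.pop 1), fun _ => 2, .const 2, fun _ i R L =>
    ((RunLe.push 1 .blank _).seq (RunLe.pop 1 _)).congr (by simp [h])⟩

@[fun_prop]
theorem id : PolyTime fun a : α => a := of_enc_eq fun _ => rfl

@[fun_prop]
theorem comp {g : β → γ} {f : α → β} (hg : PolyTime g) (hf : PolyTime f) :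
    PolyTime fun a => g (f a) :=
  let ⟨_, _, hb₁, h₁⟩ := hf
  let ⟨_, _, hb₂, h₂⟩ := hg
  ⟨_, _, hb₁.add (hb₂.comp hf.sz_bd), fun a => (h₁ a).seq (h₂ (f a))⟩

/-- A function that acts on encodings as a polynomial-time function on trees. -/
theorem of_tree {g : BTree → BTree} (hg : PolyTime g) {f : α → β}
    (h : ∀ a, enc (f a) = g (enc a)) : PolyTime f :=
  (hg.comp (of_enc_eq (f := fun a : α => enc a) fun _ => rfl)).congr_enc h

@[fun_prop]
theorem const (b : β) : PolyTime fun _ : α => b :=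
  ⟨.seq drop (pushList 1 (enc b).ser), fun a => (9 * sz a + 3) + ((enc b).ser.length + 2),
    (((PolyBd.const 9).mul .sz).add (.const 3)).add (.const _), fun _ i R L =>
      (runLe_drop _ i R L).seq (runLe_pushList_one _ i R L [] [] [])⟩

@[fun_prop]
theorem prodMk {f : α → β} {g : α → γ} (hf : PolyTime f) (hg : PolyTime g) :
    PolyTime fun a => (f a, g a) := by
  obtain ⟨c, b, hb, hc⟩ := hf
  have hg' := hg.sz_bd
  obtain ⟨d, e, he, hd⟩ := hg
  -- The upper copy becomes `g a`, the swap brings `a` back to the top, `c` turns it into `f a`, and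
  -- the pushed bit joins both trees into a node.
  refine ⟨.seq dup (.seq d (.seq swap (.seq c (.push 1 (.bit true))))),
    fun a => (20 * sz a + 5) + (e a + ((19 * sz (g a) + 19 * sz a + 10) + (b a + 1))),
    ((PolyBd.const 20).mul .sz |>.add (.const 5)).add (he.add (.add ((((PolyBd.const 19).mul hg').add
      ((PolyBd.const 19).mul .sz)).add (.const 10)) (hb.add (.const 1)))), fun a i R L => ?_⟩
  refine (runLe_dup _ i R L).seq ((hd a i _ L).seq ((runLe_swap _ _ i R L).seq ((hc a i _ L).seq
    ((RunLe.push 1 _ _).congr ?_))))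
  simp [ser]

theorem left : PolyTime BTree.left := by
  refine ⟨.cases 1 fun o => bif isOne o then .seq (.pop 1) (.seq swap drop)
    else .seq (.push 1 .blank) (.pop 1), fun a => 28 * sz a + 20,
    ((PolyBd.const 28).mul .sz).add (.const 20), fun a i R L => ?_⟩
  cases a with
  | nil =>
    exact ((RunLe.cases ((RunLe.push 1 .blank _).seq (RunLe.pop 1 _))).mono
      (t' := 28 * sz nil + 20) (by omega)).congr (by simp [BTree.left])
  | node x y =>
    have h1 := RunLe.pop 1 (st i ((node x y).ser ++ R) L [] [] [])
    have h2 := runLe_swap x y i R L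
    have h3 := runLe_drop y i (x.ser ++ R) L
    simp [ser] at h1
    exact (RunLe.cases ((h1.congr_left (by simp [ser])).seq (h2.seq h3))).mono
      (t' := 28 * sz (node x y) + 20) (by simp [sz, BTree.size]; omega)

theorem right : PolyTime BTree.right := by
  refine ⟨.cases 1 fun o => bif isOne o then .seq (.pop 1) drop
    else .seq (.push 1 .blank) (.pop 1), fun a => 28 * sz a + 20,
    ((PolyBd.const 28).mul .sz).add (.const 20), fun a i R L => ?_⟩
  cases a with
  | nil =>
    exact ((RunLe.cases ((RunLe.push 1 .blank _).seq (RunLe.pop 1 _))).mono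
      (t' := 28 * sz nil + 20) (by omega)).congr (by simp [BTree.right])
  | node x y =>
    have h1 := RunLe.pop 1 (st i ((node x y).ser ++ R) L [] [] [])
    have h3 := runLe_drop x i (y.ser ++ R) L
    simp [ser] at h1
    exact (RunLe.cases ((h1.congr_left (by simp [ser])).seq h3)).mono
      (t' := 28 * sz (node x y) + 20) (by simp [sz, BTree.size]; omega)

@[fun_prop]
theorem fst {f : α → β × γ} (hf : PolyTime f) : PolyTime fun a => (f a).1 :=
  comp (g := Prod.fst) (of_tree left fun _ => rfl) hf

@[fun_prop]
theorem snd {f : α → β × γ} (hf : PolyTime f) : PolyTime fun a => (f a).2 :=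
  comp (g := Prod.snd) (of_tree right fun _ => rfl) hf

@[fun_prop]
theorem cond {c : α → Bool} {f g : α → β} (hc : PolyTime c) (hf : PolyTime f) (hg : PolyTime g) :
    PolyTime fun a => bif c a then f a else g a := by
  obtain ⟨d, b, hb, hd⟩ := hc.prodMk (id (α := α))
  obtain ⟨d₁, b₁, hb₁, hd₁⟩ := hf
  obtain ⟨d₂, b₂, hb₂, hd₂⟩ := hg
  -- After the pair mark is popped, the truth value lies above a copy of `a`. The tree of `true` has
  -- three symbols and that of `false` one, which explains the different numbers of pops.
  refine ⟨.seq d (.seq (.pop 1) (.cases 1 fun o => bif isOne o then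
    .seq (.pop 1) (.seq (.pop 1) (.seq (.pop 1) d₁)) else .seq (.pop 1) d₂)),
    fun a => b a + (1 + ((3 + (b₁ a + b₂ a)) + 1)),
    hb.add ((PolyBd.const 1).add (((PolyBd.const 3).add (hb₁.add hb₂)).add (.const 1))),
    fun a i R L => ?_⟩
  have h0 := hd a i R L
  have h1 := hd₁ a i R L
  have h2 := hd₂ a i R L
  refine h0.seq (((RunLe.pop 1 _).congr (S'' := st i ((enc (c a)).ser ++ ((enc a).ser ++ R)) L
    [] [] []) (by simp [ser])).seq (RunLe.cases ?_))
  cases h : c a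
  · refine RunLe.mono (t := 1 + b₂ a) ?_ (by omega)
    simp only [h, cond_false] at h2 ⊢
    exact (RunLe.pop 1 _).seq (h2.congr_left (by simp [ser]))
  · refine RunLe.mono (t := 1 + (1 + (1 + b₁ a))) ?_ (by omega)
    simp only [h, cond_true] at h1 ⊢
    exact (RunLe.pop 1 _).seq ((RunLe.pop 1 _).seq ((RunLe.pop 1 _).seq
      (h1.congr_left (by simp [ser]))))

@[fun_prop]
theorem ite {P : α → Prop} [∀ a, Decidable (P a)] {f g : α → β} (hP : PolyTime P)
    (hf : PolyTime f) (hg : PolyTime g) : PolyTime fun a => if P a then f a else g a := by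
  refine (cond (c := fun a => decide (P a)) (hP.congr_enc fun a => (enc_prop _).symm) hf hg).congr_enc
    fun a => ?_
  by_cases h : P a <;> simp [h]

@[fun_prop]
theorem cons {f : α → β} {g : α → List β} (hf : PolyTime f) (hg : PolyTime g) :
    PolyTime fun a => f a :: g a := (hf.prodMk hg).congr_enc fun _ => rfl

/-- Folding over a list, with polynomially bounded intermediate results. -/
theorem foldl_aux {l : α → List β} {s : α → δ} {step : δ → β → δ}
    (hls : PolyTime fun a => (l a, s a)) (hstep : PolyTime fun x : β × δ => step x.2 x.1)
    {Q : α → ℕ} (hQ : PolyBd Q)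
    (bd : ∀ a l₁ l₂, l a = l₁ ++ l₂ → sz (l₁.foldl step (s a)) ≤ Q a) :
    PolyTime fun a => (l a).foldl step (s a) := by
  have hsz := hls.sz_bd
  obtain ⟨c, b, hb, hc⟩ := hls
  obtain ⟨d, e, ⟨p, hp⟩, hd⟩ := hstep
  -- The accumulator lies on stack 1 and the unread list on stack 2. Each round drops the node mark
  -- of the list, moves its head above the accumulator, and pushes a mark that makes the two a pair
  -- for `d`.
  let body : Cmd := .seq (.pop 2) (.seq (grab 2) (.seq (moveAll 3 1) (.seq (.push 1 (.bit true)) d)))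
  let T : α → ℕ := fun a => 12 * sz (l a, s a) + 10 + p.eval (1 + sz (l a, s a) + Q a)
  have hT : PolyBd T := ((PolyBd.const 12).mul hsz |>.add (.const 10)).add
    (((PolyBd.const 1).add hsz |>.add hQ).eval p)
  -- Loop invariant: `l₁` is already folded and `l₂` is still to be read. Each round costs at most
  -- `T a`, because the accumulator is always a fold of a prefix and so bounded by `Q a`.
  have key : ∀ (a : α) (l₂ l₁ : List β) (i R L : List Γ'), l a = l₁ ++ l₂ →
      RunLe (.loop 2 isOne body)
        (st i ((enc (l₁.foldl step (s a))).ser ++ R) ((enc l₂).ser ++ L) [] [] [])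
        (l₂.length * T a + 1)
        (st i ((enc ((l a).foldl step (s a))).ser ++ R) ((nil).ser ++ L) [] [] []) := by
    intro a l₂
    induction l₂ with
    | nil =>
      intro l₁ i R L h
      refine (RunLe.loop_done (by simp [ser, isOne])).mono (by omega) |>.congr ?_
      simp [h]
    | cons x l₂ ih =>
      intro l₁ i R L h
      set v := l₁.foldl step (s a) with hv
      have h1 := RunLe.pop 2 (st i ((enc v).ser ++ R) ((enc (x :: l₂)).ser ++ L) [] [] [])
      have h2 := runLe_grab_two (enc x) i ((enc v).ser ++ R) ((enc l₂).ser ++ L) [] []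
      have h3 := runLe_moveAll (j := 3) (k := 1) (by decide)
        (st i ((enc v).ser ++ R) ((enc l₂).ser ++ L) (enc x).ser.reverse [] [])
      have h4 := RunLe.push 1 (.bit true)
        (st i ((enc x).ser ++ ((enc v).ser ++ R)) ((enc l₂).ser ++ L) [] [] [])
      have h5 := hd (x, v) i R ((enc l₂).ser ++ L)
      simp [ser] at h1 h2 h3 h4 h5
      have h6 := ih (l₁ ++ [x]) i R L (by simp [h])
      rw [List.foldl_append] at h6
      have hbody := h1.seq (h2.seq (h3.seq (h4.seq h5)))
      refine ((RunLe.loop_step (by simp [isOne]) hbody h6).mono ?_).congr_left (by simp [ser])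
      have hx : sz x < sz (l a) := sz_le_of_mem (by simp [h])
      have hvQ : sz v ≤ Q a := bd a l₁ _ h
      have he : e (x, v) ≤ p.eval (1 + sz (l a, s a) + Q a) :=
        (hp _).trans (eval_mono p (by simp; omega))
      have : T a = 12 * sz (l a, s a) + 10 + p.eval (1 + sz (l a, s a) + Q a) := rfl
      have h7 : (enc x).size = sz x := rfl
      simp only [List.length_cons, add_mul, one_mul, h7, sz_pair] at *
      omega
  refine ⟨.seq c (.seq (.pop 1) (.seq (grab 1) (.seq (moveAll 3 2) (.seq (.loop 2 isOne body)
    (.pop 2))))), fun a => b a + (1 + ((7 * sz (l a, s a) + 2) + ((4 * sz (l a, s a) + 1) +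
      ((sz (l a, s a) * T a + 1) + 1)))),
    hb.add ((PolyBd.const 1).add ((((PolyBd.const 7).mul hsz).add (.const 2)).add
      ((((PolyBd.const 4).mul hsz).add (.const 1)).add (((hsz.mul hT).add (.const 1)).add
        (.const 1))))), fun a i R L => ?_⟩
  have h1 := RunLe.pop 1 (st i ((enc (l a, s a)).ser ++ R) L [] [] [])
  have h2 := runLe_grab_one (enc (l a)) i ((enc (s a)).ser ++ R) L [] []
  have h3 := runLe_moveAll (j := 3) (k := 2) (by decide)
    (st i ((enc (s a)).ser ++ R) L (enc (l a)).ser.reverse [] [])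
  have h4 := key a (l a) [] i R L rfl
  have h5 := RunLe.pop 2
    (st i ((enc ((l a).foldl step (s a))).ser ++ R) ((nil).ser ++ L) [] [] [])
  simp [ser] at h1 h2 h3 h4 h5
  have h6 : (enc (l a)).size ≤ sz (l a, s a) := by simp [sz, BTree.size]; omega
  have h7 : (l a).length * T a ≤ sz (l a, s a) * T a :=
    Nat.mul_le_mul_right _ ((length_lt_sz _).le.trans h6)
  have h2' := h2.mono (t' := 7 * sz (l a, s a) + 2) (by omega)
  have h3' := h3.mono (t' := 4 * sz (l a, s a) + 1) (by omega)
  have h4' := h4.mono (t' := sz (l a, s a) * T a + 1) (by omega)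
  exact (hc a i R L).seq ((h1.congr_left (by simp [ser])).seq (h2'.seq (h3'.seq (h4'.seq h5))))

/-- Folding over a list, with polynomially bounded intermediate results. -/
theorem foldl {l : α → List β} {s : α → γ} {step : α → γ → β → γ} (hl : PolyTime l)
    (hs : PolyTime s) (hstep : PolyTime fun x : α × γ × β => step x.1 x.2.1 x.2.2)
    {Q : α → ℕ} (hQ : PolyBd Q)
    (bd : ∀ a l₁ l₂, l a = l₁ ++ l₂ → sz (l₁.foldl (step a) (s a)) ≤ Q a) :
    PolyTime fun a => (l a).foldl (step a) (s a) := by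
  -- The parameter `a` travels inside the accumulator, because the step in `foldl_aux` sees only the
  -- accumulator and one element.
  have h : ∀ (a : α) (m : List β) (t : γ),
      m.foldl (fun (d : α × γ) (b : β) => (d.1, step d.1 d.2 b)) (a, t) =
        (a, m.foldl (step a) t) := by
    intro a m
    induction m with
    | nil => intro t; rfl
    | cons x m ih => intro t; simpa using ih _
  have := foldl_aux (l := l) (s := fun a => (a, s a))
    (step := fun (d : α × γ) (b : β) => (d.1, step d.1 d.2 b)) (by fun_prop)
    (prodMk (by fun_prop) (comp (f := fun x : β × α × γ => (x.2.1, x.2.2, x.1)) hstep (by fun_prop)))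
    (Q := fun a => 1 + sz a + Q a) ((PolyBd.const 1).add .sz |>.add hQ) (fun a l₁ l₂ e => by
      rw [h]; have := bd a l₁ l₂ e; simp; omega)
  simp only [h] at this
  exact this.snd

end PolyTime

namespace PolyTime

variable {α β γ δ : Type} [Enc α] [Enc β] [Enc γ] [Enc δ]

/-! ### Propositions -/

@[fun_prop]
theorem eq_true {b : α → Bool} (hb : PolyTime b) : PolyTime fun a => (b a = true) :=
  hb.congr_enc fun a => by rw [enc_prop]; simp

theorem prop_congr {P Q : α → Prop} (hP : PolyTime P) (h : ∀ a, Q a ↔ P a) : PolyTime Q :=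
  hP.congr_enc fun a => by rw [propext (h a)]

@[fun_prop]
theorem not {P : α → Prop} (hP : PolyTime P) : PolyTime fun a => ¬ P a := by
  classical
  exact (ite hP (const False) (const True)).prop_congr fun a => by by_cases h : P a <;> simp [h]

@[fun_prop]
theorem and {P Q : α → Prop} (hP : PolyTime P) (hQ : PolyTime Q) : PolyTime fun a => P a ∧ Q a := by
  classical
  exact (ite hP hQ (const False)).prop_congr fun a => by by_cases h : P a <;> simp [h]

@[fun_prop]
theorem or {P Q : α → Prop} (hP : PolyTime P) (hQ : PolyTime Q) : PolyTime fun a => P a ∨ Q a := by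
  classical
  exact (ite hP (const True) hQ).prop_congr fun a => by by_cases h : P a <;> simp [h]

theorem isNode : PolyTime fun x : BTree => x ≠ nil := by
  refine ⟨.cases 1 fun o => bif isOne o then .seq drop (pushList 1 (node nil nil).ser)
    else .seq (.push 1 .blank) (.pop 1), fun a => 9 * sz a + 20,
    ((PolyBd.const 9).mul .sz).add (.const 20), fun a i R L => ?_⟩
  cases a with
  | nil =>
    refine ((RunLe.cases ((RunLe.push 1 .blank _).seq (RunLe.pop 1 _))).mono
      (t' := 9 * sz nil + 20) (by omega)).congr ?_
    simp [enc]
  | node x y =>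
    have h1 := runLe_drop (node x y) i R L
    have h2 := runLe_pushList_one (node nil nil).ser i R L [] [] []
    refine ((RunLe.cases (h1.seq h2)).mono
      (t' := 9 * sz (node x y) + 20) (by simp [sz, BTree.size, ser])).congr ?_
    simp [enc]

/-- Comparison with a fixed tree. -/
theorem eq_const_tree (t : BTree) : PolyTime fun x : BTree => x = t := by
  induction t with
  | nil => exact isNode.not.prop_congr fun a => by simp
  | node a b iha ihb =>
    refine (isNode.and ((iha.comp left).and (ihb.comp right))).prop_congr fun x => ?_
    cases x <;> simp [BTree.left, BTree.right]

theorem eq_const {f : α → β} (hf : PolyTime f) (hi : Function.Injective (enc : β → BTree)) (b : β) :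
    PolyTime fun a => f a = b :=
  (comp (g := fun x : BTree => x = enc b) (eq_const_tree _) (hf.congr_enc (g := fun a => enc (f a))
    fun _ => rfl)).prop_congr fun _ => hi.eq_iff.symm

@[fun_prop]
theorem eq_nil {l : α → List β} (hl : PolyTime l) : PolyTime fun a => l a = [] :=
  (comp (g := fun x : BTree => x = nil) (eq_const_tree _) (hl.congr_enc (g := fun a => enc (l a))
    fun _ => rfl)).prop_congr fun a => by cases l a <;> simp

/-! ### Lists -/

@[fun_prop]
theorem tail {l : α → List β} (hl : PolyTime l) : PolyTime fun a => (l a).tail :=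
  comp (g := List.tail) (of_tree right fun l => by cases l <;> rfl) hl

theorem headD {l : α → List β} (hl : PolyTime l) {d : β} (hd : enc d = nil) :
    PolyTime fun a => (l a).headD d :=
  comp (g := fun l : List β => l.headD d) (of_tree left fun l => by cases l <;> simp [hd, BTree.left]) hl

@[fun_prop]
theorem reverse {l : α → List β} (hl : PolyTime l) : PolyTime fun a => (l a).reverse := by
  have h := foldl (s := fun _ : α => ([] : List β)) (step := fun _ m b => b :: m) hl (by fun_prop)
    (by fun_prop) hl.sz_bd fun a l₁ l₂ h => by
      have := sz_append l₁ l₂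
      have := one_le_sz l₂
      simp [sz_reverse, h]; omega
  simpa using h

/-- Folding a list from the right, with polynomially bounded intermediate results. -/
theorem foldr {l : α → List β} {s : α → γ} {step : α → β → γ → γ} (hl : PolyTime l)
    (hs : PolyTime s) (hstep : PolyTime fun x : α × β × γ => step x.1 x.2.1 x.2.2)
    {Q : α → ℕ} (hQ : PolyBd Q)
    (bd : ∀ a l₁ l₂, l a = l₁ ++ l₂ → sz (l₂.foldr (step a) (s a)) ≤ Q a) :
    PolyTime fun a => (l a).foldr (step a) (s a) := by
  have h := foldl (l := fun a => (l a).reverse) (s := s) (step := fun a c b => step a b c)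
    (by fun_prop) hs
    (comp (f := fun x : α × γ × β => (x.1, x.2.2, x.2.1)) hstep (by fun_prop)) hQ
    fun a l₁ l₂ h => by
      have := bd a l₂.reverse l₁.reverse (by rw [← List.reverse_append, ← h, List.reverse_reverse])
      simpa using this
  simpa using h

@[fun_prop]
theorem append {l m : α → List β} (hl : PolyTime l) (hm : PolyTime m) :
    PolyTime fun a => l a ++ m a := by
  have h := foldr (step := fun _ b c => b :: c) hl hm (by fun_prop) (hl.sz_bd.add hm.sz_bd)
    fun a l₁ l₂ h => by
      have := sz_append l₁ l₂
      have := sz_append l₂ (m a)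
      have := one_le_sz l₁
      simp [h]; omega
  simpa using h

@[fun_prop]
theorem map {l : α → List β} {h : α → β → γ} (hl : PolyTime l)
    (hh : PolyTime fun x : α × β => h x.1 x.2) : PolyTime fun a => (l a).map (h a) := by
  obtain ⟨p, hp⟩ := hh.sz_bd
  have := foldr (s := fun _ => ([] : List γ)) (step := fun a b c => h a b :: c) hl (by fun_prop)
    (cons (hh.comp (f := fun x : α × β × List γ => (x.1, x.2.1)) (by fun_prop)) (by fun_prop))
    -- At most `sz (l a)` results, each polynomially bounded because elements of a list are smaller
    -- than the list.
    (Q := fun a => sz (l a) * (p.eval (1 + sz a + sz (l a)) + 1) + 1)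
    ((hl.sz_bd.mul ((((PolyBd.const 1).add .sz |>.add hl.sz_bd).eval p).add (.const 1))).add (.const 1))
    fun a l₁ l₂ e => by
      have h1 : l₂.foldr (fun b c => h a b :: c) [] = l₂.map (h a) := by
        simp
      rw [h1]
      have h2 : ∀ y ∈ l₂.map (h a), sz y ≤ p.eval (1 + sz a + sz (l a)) := by
        intro y hy
        obtain ⟨x, hx, rfl⟩ := List.mem_map.1 hy
        have : sz x < sz (l a) := sz_le_of_mem (by simp [e, hx])
        exact (hp (a, x)).trans (eval_mono p (by simp; omega))
      refine (sz_le_of_forall h2).trans ?_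
      have h3 : l₂.length ≤ sz (l a) := by
        have := length_lt_sz (l a)
        simp [e] at this ⊢; omega
      rw [List.length_map]
      exact Nat.add_le_add_right (Nat.mul_le_mul_right _ h3) 1
  simpa using this

end PolyTime

/-! ### Binary numbers -/

theorem sz_nat_le (n : ℕ) : sz n ≤ 4 * n.size + 1 := by
  have : sz n ≤ n.bits.length * (3 + 1) + 1 := sz_le_of_forall (l := n.bits) fun b _ => by
    cases b <;> simp [sz, BTree.size]
  rw [Nat.size_eq_bits_len] at this
  omega

theorem lt_two_pow_sz (n : ℕ) : n < 2 ^ sz n := by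
  refine Nat.size_le.1 ?_
  rw [← Nat.size_eq_bits_len]
  exact (length_lt_sz n.bits).le

theorem sz_le_of_lt_two_pow {n t : ℕ} (h : n < 2 ^ t) : sz n ≤ 4 * t + 1 := by
  have := Nat.size_le.2 h
  have := sz_nat_le n
  omega

/-- The number with the given binary digits, least significant digit first. -/
def natOf (l : List Bool) : ℕ := l.foldr Nat.bit 0

@[simp] theorem natOf_nil : natOf [] = 0 := rfl
@[simp] theorem natOf_cons (b : Bool) (l : List Bool) : natOf (b :: l) = Nat.bit b (natOf l) := rfl

/-- The exceptional case keeps the digits free of leading zeros, so that each number has exactly one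
tree. -/
theorem bits_bit (b : Bool) (n : ℕ) :
    (Nat.bit b n).bits = if b = false ∧ n = 0 then [] else b :: n.bits := by
  split_ifs with h
  · obtain ⟨rfl, rfl⟩ := h; simp
  · exact Nat.bits_append_bit n b fun hn => by
      cases b
      · exact absurd ⟨rfl, hn⟩ h
      · rfl

theorem natOf_bits (n : ℕ) : natOf n.bits = n := by
  induction n using Nat.binaryRec' with
  | zero => simp
  | bit b n h ih => rw [Nat.bits_append_bit n b h, natOf_cons, ih]

theorem sz_bit_le (b : Bool) (n : ℕ) : sz (Nat.bit b n) ≤ 1 + sz b + sz n := by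
  change sz (Nat.bit b n).bits ≤ 1 + sz b + sz n.bits
  rw [bits_bit]
  split_ifs
  · simp; omega
  · simp

theorem natOf_lt (l : List Bool) : natOf l < 2 ^ l.length := by
  induction l with
  | nil => simp
  | cons b l ih => rw [natOf_cons, List.length_cons, pow_succ]; cases b <;> simp [Nat.bit] <;> omega

theorem sz_natOf_le (l : List Bool) : sz (natOf l) ≤ sz l := by
  induction l with
  | nil => simp [sz, enc_nat, BTree.size]
  | cons b l ih =>
    refine (sz_bit_le b (natOf l)).trans ?_
    rw [sz_list_cons]; omega

theorem bits_eq_nil {n : ℕ} : n.bits = [] ↔ n = 0 := by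
  constructor
  · intro h; simpa [h] using (natOf_bits n).symm
  · rintro rfl; simp

theorem encodeNat_eq_bits (n : ℕ) : Computability.encodeNat n = n.bits := by
  have hp : ∀ m : PosNum, Computability.encodePosNum m = (m : ℕ).bits := by
    intro m
    induction m with
    | one => simp [Computability.encodePosNum]
    | bit0 m ih =>
      rw [Computability.encodePosNum, ih, PosNum.cast_bit0, ← two_mul]
      exact (Nat.bits_append_bit (m : ℕ) false fun h => absurd h m.to_nat_pos.ne').symm
    | bit1 m ih =>
      rw [Computability.encodePosNum, ih, PosNum.cast_bit1, ← two_mul]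
      exact (Nat.bits_append_bit (m : ℕ) true fun _ => rfl).symm
  have hn : ∀ m : Num, Computability.encodeNum m = (m : ℕ).bits := by
    intro m
    cases m with
    | zero => simp [Computability.encodeNum]
    | pos m => exact hp m
  rw [Computability.encodeNat, hn, Num.to_of_nat]

/-- Pairs of corresponding elements of two lists of digits, as many as the first argument says. -/
def zipBits {α : Type} : List α → List Bool → List Bool → List (Bool × Bool)
  | [], _, _ => []
  | _ :: c, l, m => (l.headD false, m.headD false) :: zipBits c l.tail m.tail

/-- Padding with `false` at the most significant end does not change the value, and `c` is long
enough that no digit is lost. -/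
theorem zipBits_fst {α : Type} (c : List α) (l m : List Bool) (h : l.length ≤ c.length) :
    natOf ((zipBits c l m).map Prod.fst) = natOf l := by
  induction c generalizing l m with
  | nil => simp at h; simp [h, zipBits]
  | cons a c ih =>
    cases l with
    | nil => simpa [zipBits, Nat.bit] using ih [] m.tail (by simp)
    | cons b l => simpa [zipBits] using congrArg (Nat.bit b) (ih l m.tail (by simpa using h))

theorem zipBits_snd {α : Type} (c : List α) (l m : List Bool) (h : m.length ≤ c.length) :
    natOf ((zipBits c l m).map Prod.snd) = natOf m := by
  induction c generalizing l m with
  | nil => simp at h; simp [h, zipBits]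
  | cons a c ih =>
    cases m with
    | nil => simpa [zipBits, Nat.bit] using ih l.tail [] (by simp)
    | cons b m => simpa [zipBits] using congrArg (Nat.bit b) (ih l.tail m (by simpa using h))

theorem zipBits_eq_foldl {α : Type} (c : List α) (l m : List Bool) (o : List (Bool × Bool)) :
    (c.foldl (fun s _ => (s.1.tail, s.2.1.tail,
      (s.1.headD false, s.2.1.headD false) :: s.2.2)) (l, m, o)).2.2 =
      (zipBits c l m).reverse ++ o := by
  induction c generalizing l m o with
  | nil => rfl
  | cons a c ih => rw [List.foldl_cons, ih]; simp [zipBits]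

/-- The corresponding digits of two numbers. -/
def zipNat (m n : ℕ) : List (Bool × Bool) := zipBits (m.bits ++ n.bits) m.bits n.bits

theorem zipNat_fst (m n : ℕ) : natOf ((zipNat m n).map Prod.fst) = m := by
  rw [zipNat, zipBits_fst _ _ _ (by simp), natOf_bits]

theorem zipNat_snd (m n : ℕ) : natOf ((zipNat m n).map Prod.snd) = n := by
  rw [zipNat, zipBits_snd _ _ _ (by simp), natOf_bits]

/-- The step of the ripple addition, which computes the sum and its successor. -/
def addStep (x : Bool × Bool) (s : ℕ × ℕ) : ℕ × ℕ :=
  bif x.1 then bif x.2 then (Nat.bit false s.2, Nat.bit true s.2)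
    else (Nat.bit true s.1, Nat.bit false s.2)
  else bif x.2 then (Nat.bit true s.1, Nat.bit false s.2)
    else (Nat.bit false s.1, Nat.bit true s.1)

/-- The fold meets the most significant digits first, before the carry from below is known. It
therefore maintains both possible results, without and with an incoming carry. -/
theorem foldr_addStep (l : List (Bool × Bool)) :
    l.foldr addStep (0, 1) = (natOf (l.map Prod.fst) + natOf (l.map Prod.snd),
      natOf (l.map Prod.fst) + natOf (l.map Prod.snd) + 1) := by
  induction l with
  | nil => rfl
  | cons x l ih =>
    obtain ⟨b, c⟩ := x
    rw [List.foldr_cons, ih]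
    cases b <;> cases c <;> simp [addStep, Nat.bit] <;> omega

/-- The step of the ripple subtraction `x - y`, which computes `x - y` and `x - y - 1` and whether
`y ≤ x` and `y < x`. -/
def subStep (x : Bool × Bool) (s : (ℕ × ℕ) × (Bool × Bool)) : (ℕ × ℕ) × (Bool × Bool) :=
  bif x.1 then bif x.2 then ((Nat.bit false s.1.1, bif s.2.2 then Nat.bit true s.1.2 else 0), s.2)
    else ((bif s.2.1 then Nat.bit true s.1.1 else 0, Nat.bit false s.1.1), s.2.1, s.2.1)
  else bif x.2 then ((bif s.2.2 then Nat.bit true s.1.2 else 0, Nat.bit false s.1.2), s.2.2, s.2.2)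
    else ((Nat.bit false s.1.1, bif s.2.2 then Nat.bit true s.1.2 else 0), s.2)

/-- As for addition, the results without and with a borrow are kept. Truncation at zero loses the
sign, so the two comparisons are carried along to decide whether the lower digits still count. -/
theorem foldr_subStep (l : List (Bool × Bool)) :
    l.foldr subStep ((0, 0), (true, false)) =
      ((natOf (l.map Prod.fst) - natOf (l.map Prod.snd),
        natOf (l.map Prod.fst) - natOf (l.map Prod.snd) - 1),
        (decide (natOf (l.map Prod.snd) ≤ natOf (l.map Prod.fst)),
        decide (natOf (l.map Prod.snd) < natOf (l.map Prod.fst)))) := by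
  have h₀ : ∀ n, Nat.bit false n = 2 * n := fun _ => rfl
  have h₁ : ∀ n, Nat.bit true n = 2 * n + 1 := fun _ => rfl
  induction l with
  | nil => rfl
  | cons x l ih =>
    obtain ⟨b, c⟩ := x
    rw [List.foldr_cons, ih]
    simp only [List.map_cons, natOf_cons]
    generalize natOf (l.map Prod.fst) = m
    generalize natOf (l.map Prod.snd) = n
    rcases lt_trichotomy m n with h | h | h
    · have h1 : ¬ n ≤ m := by omega
      have h2 : ¬ n < m := by omega
      cases b <;> cases c <;> simp [subStep, h₀, h₁, h1, h2] <;> omega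
    · subst h
      cases b <;> cases c <;> simp [subStep, h₀, h₁]
    · have h1 : n ≤ m := by omega
      cases b <;> cases c <;> simp [subStep, h₀, h₁, h1, h] <;> omega

namespace PolyTime

variable {α β γ δ : Type} [Enc α] [Enc β] [Enc γ] [Enc δ]

theorem bits {n : α → ℕ} (hn : PolyTime n) : PolyTime fun a => (n a).bits :=
  hn.congr_enc fun _ => rfl

@[fun_prop]
theorem eq_zero {n : α → ℕ} (hn : PolyTime n) : PolyTime fun a => n a = 0 :=
  hn.bits.eq_nil.prop_congr fun _ => bits_eq_nil.symm

@[fun_prop]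
theorem bit {b : α → Bool} {n : α → ℕ} (hb : PolyTime b) (hn : PolyTime n) :
    PolyTime fun a => Nat.bit (b a) (n a) := by
  have := hn.bits
  have h : PolyTime fun a => if b a = true ∨ ¬ n a = 0 then b a :: (n a).bits else [] := by fun_prop
  refine h.congr_enc fun a => ?_
  rw [enc_nat, bits_bit]
  cases b a <;> by_cases h0 : n a = 0 <;> simp [h0]

@[fun_prop]
protected theorem natOf {l : α → List Bool} (hl : PolyTime l) : PolyTime fun a => natOf (l a) :=
  foldr (s := fun _ => 0) (step := fun _ b n => Nat.bit b n) hl (by fun_prop) (by fun_prop) hl.sz_bd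
    fun a l₁ l₂ e => by
      have := sz_append l₁ l₂
      have := one_le_sz l₁
      refine (sz_natOf_le l₂).trans ?_
      rw [e]; omega

protected theorem zipNat {m n : α → ℕ} (hm : PolyTime m) (hn : PolyTime n) :
    PolyTime fun a => zipNat (m a) (n a) := by
  have hm' := hm.bits
  have hn' := hn.bits
  have htl : ∀ l : List Bool, sz l.tail ≤ sz l := by
    intro l; cases l <;> simp
  have hhd : ∀ b : Bool, sz b ≤ 3 := by decide
  have hsz : ∀ (c l m : List Bool) (o : List (Bool × Bool)),
      sz (c.foldl (fun s _ => (s.1.tail, s.2.1.tail,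
        (s.1.headD false, s.2.1.headD false) :: s.2.2)) (l, m, o)) ≤
      sz l + sz m + sz o + 8 * c.length + 2 := by
    intro c
    induction c with
    | nil => intro l m o; simp only [List.foldl_nil, sz_pair]; omega
    | cons a c ih =>
      intro l m o
      rw [List.foldl_cons]
      refine (ih _ _ _).trans ?_
      have := htl l
      have := htl m
      have := hhd (l.headD false)
      have := hhd (m.headD false)
      simp only [sz_list_cons, sz_pair, List.length_cons]
      omega
  have h := foldl (l := fun a => (m a).bits ++ (n a).bits)
    (s := fun a => ((m a).bits, (n a).bits, ([] : List (Bool × Bool))))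
    (step := fun _ s _ => (s.1.tail, s.2.1.tail, (s.1.headD false, s.2.1.headD false) :: s.2.2))
    (hm'.append hn') (by fun_prop)
    (prodMk (by fun_prop) (prodMk (by fun_prop) (cons (prodMk (headD (by fun_prop) rfl)
      (headD (by fun_prop) rfl)) (by fun_prop))))
    (Q := fun a => sz (m a).bits + sz (n a).bits + 1 +
      8 * sz ((m a).bits ++ (n a).bits) + 2)
    ((((hm'.sz_bd.add hn'.sz_bd).add (.const 1)).add ((PolyBd.const 8).mul
      (hm'.append hn').sz_bd)).add (.const 2)) fun a l₁ l₂ e => by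
        refine (hsz _ _ _ _).trans ?_
        have h1 := length_lt_sz ((m a).bits ++ (n a).bits)
        have h2 : l₁.length ≤ ((m a).bits ++ (n a).bits).length := by rw [e]; simp
        simp only [sz_list_nil]
        omega
  have h' := h.snd.snd.reverse
  simp only [zipBits_eq_foldl] at h'
  simpa [zipNat] using h'

@[fun_prop]
theorem add {m n : α → ℕ} (hm : PolyTime m) (hn : PolyTime n) : PolyTime fun a => m a + n a := by
  have hz := PolyTime.zipNat hm hn
  have h := foldr (s := fun _ : α => ((0, 1) : ℕ × ℕ)) (step := fun _ x s => addStep x s)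
    hz (by fun_prop) (by unfold addStep; fun_prop)
    (Q := fun a => 8 * sz (zipNat (m a) (n a)) + 11)
    (((PolyBd.const 8).mul hz.sz_bd).add (.const 11)) fun a l₁ l₂ e => by
      rw [foldr_addStep, sz_pair]
      have h1 := natOf_lt (l₂.map Prod.fst)
      have h2 := natOf_lt (l₂.map Prod.snd)
      rw [List.length_map] at h1 h2
      have h3 : sz (natOf (l₂.map Prod.fst) + natOf (l₂.map Prod.snd)) ≤ 4 * (l₂.length + 1) + 1 :=
        sz_le_of_lt_two_pow (by rw [pow_succ]; omega)
      have h4 : sz (natOf (l₂.map Prod.fst) + natOf (l₂.map Prod.snd) + 1) ≤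
        4 * (l₂.length + 1) + 1 := sz_le_of_lt_two_pow (by rw [pow_succ]; omega)
      have h5 := length_lt_sz (zipNat (m a) (n a))
      rw [e, List.length_append, ← e] at h5
      omega
  simp only [foldr_addStep, zipNat_fst, zipNat_snd] at h
  exact h.fst

@[fun_prop]
theorem sub {m n : α → ℕ} (hm : PolyTime m) (hn : PolyTime n) : PolyTime fun a => m a - n a := by
  have hz := PolyTime.zipNat hm hn
  have h := foldr (s := fun _ : α => (((0, 0), (true, false)) : (ℕ × ℕ) × (Bool × Bool)))
    (step := fun _ x s => subStep x s)
    hz (by fun_prop) (by unfold subStep; fun_prop)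
    (Q := fun a => 8 * sz (zipNat (m a) (n a)) + 19)
    (((PolyBd.const 8).mul hz.sz_bd).add (.const 19)) fun a l₁ l₂ e => by
      rw [foldr_subStep, sz_pair, sz_pair, sz_pair]
      have h1 := natOf_lt (l₂.map Prod.fst)
      rw [List.length_map] at h1
      have h3 : sz (natOf (l₂.map Prod.fst) - natOf (l₂.map Prod.snd)) ≤ 4 * (l₂.length + 1) + 1 :=
        sz_le_of_lt_two_pow (by rw [pow_succ]; omega)
      have h4 : sz (natOf (l₂.map Prod.fst) - natOf (l₂.map Prod.snd) - 1) ≤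
        4 * (l₂.length + 1) + 1 := sz_le_of_lt_two_pow (by rw [pow_succ]; omega)
      have h5 := length_lt_sz (zipNat (m a) (n a))
      rw [e, List.length_append, ← e] at h5
      have hb : ∀ b : Bool, sz b ≤ 3 := by decide
      have := hb (Decidable.decide (natOf (l₂.map Prod.snd) ≤ natOf (l₂.map Prod.fst)))
      have := hb (Decidable.decide (natOf (l₂.map Prod.snd) < natOf (l₂.map Prod.fst)))
      omega
  simp only [foldr_subStep, zipNat_fst, zipNat_snd] at h
  exact h.fst.fst

@[fun_prop]
theorem le {m n : α → ℕ} (hm : PolyTime m) (hn : PolyTime n) : PolyTime fun a => m a ≤ n a :=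
  (sub hm hn).eq_zero.prop_congr fun _ => Nat.sub_eq_zero_iff_le.symm

@[fun_prop]
theorem lt {m n : α → ℕ} (hm : PolyTime m) (hn : PolyTime n) : PolyTime fun a => m a < n a :=
  (le hn hm).not.prop_congr fun _ => Nat.not_le.symm

@[fun_prop]
theorem eq {m n : α → ℕ} (hm : PolyTime m) (hn : PolyTime n) : PolyTime fun a => m a = n a :=
  ((le hm hn).and (le hn hm)).prop_congr fun _ => le_antisymm_iff

@[fun_prop]
theorem max {m n : α → ℕ} (hm : PolyTime m) (hn : PolyTime n) :
    PolyTime fun a => Max.max (m a) (n a) :=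
  (ite (le hm hn) hn hm).congr_enc fun a => by rw [max_def]

/-- Horner's scheme on the binary digits of the first factor. -/
theorem foldr_mul (l : List Bool) (n : ℕ) :
    l.foldr (fun b s => Nat.bit false s + bif b then n else 0) 0 = natOf l * n := by
  induction l with
  | nil => simp
  | cons b l ih =>
    rw [List.foldr_cons, ih, natOf_cons]
    cases b <;> simp [Nat.bit] <;> ring

@[fun_prop]
theorem mul {m n : α → ℕ} (hm : PolyTime m) (hn : PolyTime n) : PolyTime fun a => m a * n a := by
  have hb := hm.bits
  have h := foldr (s := fun _ : α => 0)
    (step := fun a b s => Nat.bit false s + bif b then n a else 0)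
    hb (by fun_prop) (by fun_prop)
    (Q := fun a => 4 * (sz (m a).bits + sz (n a)) + 1)
    (((PolyBd.const 4).mul (hb.sz_bd.add hn.sz_bd)).add (.const 1)) fun a l₁ l₂ e => by
      rw [foldr_mul]
      refine (sz_le_of_lt_two_pow (t := l₂.length + sz (n a)) ?_).trans ?_
      · rw [pow_add]
        exact Nat.mul_lt_mul'' (natOf_lt _) (lt_two_pow_sz _)
      · have h5 := length_lt_sz (m a).bits
        rw [e, List.length_append, ← e] at h5
        omega
  simpa only [foldr_mul, natOf_bits] using h

end PolyTime

namespace PolyTime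

variable {α β γ δ : Type} [Enc α] [Enc β] [Enc γ] [Enc δ]

/-! ### Ranges and big operators -/

/-- A binary number may be exponentially larger than its code, so loops cannot be bounded by
arbitrary numbers. Computability of `List.range (n a)` is the form in which "`n` is polynomially
bounded and computable" is used below. Lengths of computed lists are the source of such bounds. -/
theorem range_length {l : α → List β} (hl : PolyTime l) :
    PolyTime fun a => List.range (l a).length := by
  have hf : ∀ m : List β, m.foldr (fun _ (s : ℕ × List ℕ) => (s.1 + 1, s.2 ++ [s.1])) (0, []) =
      (m.length, List.range m.length) := by
    intro m
    induction m with
    | nil => rfl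
    | cons b m ih => simp [ih, List.range_succ]
  have hb : ∀ n : ℕ, sz n ≤ 4 * n + 1 := fun n => sz_le_of_lt_two_pow Nat.lt_two_pow_self
  have h := foldr (s := fun _ : α => ((0, []) : ℕ × List ℕ))
    (step := fun _ _ s => (s.1 + 1, s.2 ++ [s.1])) hl (by fun_prop) (by fun_prop)
    (Q := fun a => (4 * sz (l a) + 2) + (sz (l a) * ((4 * sz (l a) + 1) + 1) + 1))
    ((((PolyBd.const 4).mul hl.sz_bd).add (.const 2)).add
      ((hl.sz_bd.mul ((((PolyBd.const 4).mul hl.sz_bd).add (.const 1)).add (.const 1))).add (.const 1)))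
    fun a l₁ l₂ e => by
      have h1 : l₂.length ≤ sz (l a) := by
        have := length_lt_sz (l a)
        simp [e] at this ⊢; omega
      have h2 : sz (List.range l₂.length) ≤ _ := sz_le_of_forall (B := 4 * sz (l a) + 1)
        fun x hx => (hb x).trans (by have := List.mem_range.1 hx; omega)
      rw [List.length_range] at h2
      have h3 := hb l₂.length
      have h4 := Nat.mul_le_mul_right ((4 * sz (l a) + 1) + 1) h1
      rw [hf, sz_pair]
      omega
  simp only [hf] at h
  exact h.snd

@[fun_prop]
theorem length {l : α → List β} (hl : PolyTime l) : PolyTime fun a => (l a).length := by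
  have hf : ∀ m : List β, m.foldr (fun _ s => s + 1) 0 = m.length := by
    intro m
    induction m with
    | nil => rfl
    | cons b m ih => simp [ih]
  have h := foldr (s := fun _ : α => 0) (step := fun _ _ s => s + 1) hl (by fun_prop) (by fun_prop)
    (Q := fun a => 4 * sz (l a) + 1) (((PolyBd.const 4).mul hl.sz_bd).add (.const 1))
    fun a l₁ l₂ e => by
      have h1 := length_lt_sz (l a)
      rw [e, List.length_append, ← e] at h1
      have : sz l₂.length ≤ 4 * l₂.length + 1 := sz_le_of_lt_two_pow Nat.lt_two_pow_self
      rw [hf]; omega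
  simpa only [hf] using h

theorem range_of_eq {n : α → ℕ} {l : α → List β} (hl : PolyTime l) (h : ∀ a, (l a).length = n a) :
    PolyTime fun a => List.range (n a) := by
  simpa only [h] using hl.range_length

theorem of_range {n : α → ℕ} (hn : PolyTime fun a => List.range (n a)) : PolyTime n := by
  simpa using hn.length

theorem range_succ {n : α → ℕ} (hn : PolyTime fun a => List.range (n a)) :
    PolyTime fun a => List.range (n a + 1) :=
  range_of_eq (l := fun a => 0 :: List.range (n a)) (by fun_prop) (by simp)

theorem range_const (k : ℕ) : PolyTime fun _ : α => List.range k := const _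

/-- Folding natural numbers over a list with an operation under which sizes are at most additive. -/
theorem foldr_op {op : ℕ → ℕ → ℕ} {z : ℕ} (hop : PolyTime fun x : ℕ × ℕ => op x.1 x.2)
    (hz : ∀ l : List ℕ, l.foldr op z < 2 ^ sz l) {l : α → List ℕ} (hl : PolyTime l) :
    PolyTime fun a => (l a).foldr op z :=
  foldr (s := fun _ => z) (step := fun _ b s => op b s) hl (const _)
    (hop.comp (f := fun x : α × ℕ × ℕ => x.2) (by fun_prop))
    (Q := fun a => 4 * sz (l a) + 1) (((PolyBd.const 4).mul hl.sz_bd).add (.const 1))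
    fun a l₁ l₂ e => by
      have := sz_append l₁ l₂
      have := one_le_sz l₁
      have := sz_le_of_lt_two_pow (hz l₂)
      change sz (l₂.foldr op z) ≤ _
      rw [e]; omega

theorem listSum {l : α → List ℕ} (hl : PolyTime l) : PolyTime fun a => (l a).sum :=
  foldr_op (op := fun a b => a + b) (by fun_prop) (fun l => by
    induction l with
    | nil => simp
    | cons b l ih =>
      have h1 := lt_two_pow_sz b
      have h2 : 2 ^ sz b ≤ 2 ^ (sz b + sz l) := Nat.pow_le_pow_right (by norm_num) (by omega)
      have h3 : 2 ^ sz l ≤ 2 ^ (sz b + sz l) := Nat.pow_le_pow_right (by norm_num) (by omega)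
      rw [List.foldr_cons, sz_list_cons, add_assoc, add_comm 1, pow_succ]
      omega) hl

theorem listProd {l : α → List ℕ} (hl : PolyTime l) : PolyTime fun a => (l a).prod :=
  foldr_op (op := fun a b => a * b) (by fun_prop) (fun l => by
    induction l with
    | nil => simp
    | cons b l ih =>
      rw [List.foldr_cons, sz_list_cons, add_assoc, add_comm 1, pow_succ, pow_add]
      exact (Nat.mul_lt_mul'' (lt_two_pow_sz b) ih).trans_le (Nat.le_mul_of_pos_right _ two_pos)) hl

theorem listMax {l : α → List ℕ} (hl : PolyTime l) : PolyTime fun a => (l a).foldr Max.max 0 :=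
  foldr_op (op := Max.max) (by fun_prop) (fun l => by
    induction l with
    | nil => simp
    | cons b l ih =>
      have h1 := lt_two_pow_sz b
      have h2 : 2 ^ sz b ≤ 2 ^ (1 + sz b + sz l) := Nat.pow_le_pow_right (by norm_num) (by omega)
      have h3 : 2 ^ sz l ≤ 2 ^ (1 + sz b + sz l) := Nat.pow_le_pow_right (by norm_num) (by omega)
      rw [List.foldr_cons, sz_list_cons]
      exact max_lt (h1.trans_le h2) (ih.trans_le h3)) hl

theorem sum_range {n : α → ℕ} {h : α → ℕ → ℕ} (hn : PolyTime fun a => List.range (n a))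
    (hh : PolyTime fun x : α × ℕ => h x.1 x.2) :
    PolyTime fun a => ∑ i ∈ Finset.range (n a), h a i := by
  have : ∀ (a : α) (m : ℕ), ∑ i ∈ Finset.range m, h a i = ((List.range m).map (h a)).sum := by
    intro a m
    induction m with
    | zero => rfl
    | succ m ih => simp [Finset.sum_range_succ, List.range_succ, ih]
  simp only [this]
  exact (hn.map hh).listSum

theorem prod_range {n : α → ℕ} {h : α → ℕ → ℕ} (hn : PolyTime fun a => List.range (n a))
    (hh : PolyTime fun x : α × ℕ => h x.1 x.2) :
    PolyTime fun a => ∏ i ∈ Finset.range (n a), h a i := by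
  have : ∀ (a : α) (m : ℕ), ∏ i ∈ Finset.range m, h a i = ((List.range m).map (h a)).prod := by
    intro a m
    induction m with
    | zero => rfl
    | succ m ih => simp [Finset.prod_range_succ, List.range_succ, ih]
  simp only [this]
  exact (hn.map hh).listProd

theorem sup_range {n : α → ℕ} {h : α → ℕ → ℕ} (hn : PolyTime fun a => List.range (n a))
    (hh : PolyTime fun x : α × ℕ => h x.1 x.2) :
    PolyTime fun a => (Finset.range (n a)).sup (h a) := by
  have : ∀ (a : α) (m : ℕ),
      (Finset.range m).sup (h a) = ((List.range m).map (h a)).reverse.foldr Max.max 0 := by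
    intro a m
    induction m with
    | zero => rfl
    | succ m ih => simp [Finset.range_add_one, List.range_succ, ih]
  simp only [this]
  exact (hn.map hh).reverse.listMax

theorem forall_lt {n : α → ℕ} {P : α → ℕ → Prop} (hn : PolyTime fun a => List.range (n a))
    (hP : PolyTime fun x : α × ℕ => P x.1 x.2) : PolyTime fun a => ∀ i < n a, P a i := by
  classical
  refine (sum_range (h := fun a i => if P a i then 0 else 1) hn (by fun_prop)).eq_zero.prop_congr
    fun a => ?_
  simp

theorem card_filter_range {n : α → ℕ} {P : α → ℕ → Prop} [∀ a, DecidablePred (P a)]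
    (hn : PolyTime fun a => List.range (n a))
    (hP : PolyTime fun x : α × ℕ => P x.1 x.2) :
    PolyTime fun a => ((Finset.range (n a)).filter (P a)).card := by
  simp only [Finset.card_filter]
  exact sum_range (h := fun a i => if P a i then 1 else 0) hn (by fun_prop)

@[fun_prop]
theorem getD {l : α → List β} {i : α → ℕ} (hl : PolyTime l) (hi : PolyTime i) (d : β) :
    PolyTime fun a => (l a).getD (i a) d := by
  -- The fold carries a position counter and replaces its value only at position `i`. Starting from
  -- `d`, it keeps `d` if `i` is out of range.
  have hf : ∀ (i : ℕ) (m : List β) (c : ℕ) (r : β),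
      m.foldl (fun (s : ℕ × β) x => (s.1 + 1, if s.1 = i then x else s.2)) (c, r) =
        (c + m.length, if c ≤ i then m.getD (i - c) r else r) := by
    intro i m
    induction m with
    | nil => simp
    | cons x m ih =>
      intro c r
      rw [List.foldl_cons, ih]
      rcases lt_trichotomy c i with h | h | h
      · obtain ⟨t, rfl⟩ := Nat.exists_eq_add_of_lt h
        have h1 : c + t + 1 - c = t + 1 := by omega
        have h2 : c + t + 1 - (c + 1) = t := by omega
        simp [h1, h2, show c ≤ c + t + 1 by omega, show c ≤ c + t by omega,
          show c ≠ c + t + 1 by omega]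
        omega
      · subst h; simp; omega
      · simp [show ¬ c ≤ i by omega, show ¬ c + 1 ≤ i by omega, show c ≠ i by omega]; omega
  have hn : ∀ n : ℕ, sz n ≤ 4 * n + 1 := fun n => sz_le_of_lt_two_pow Nat.lt_two_pow_self
  have h := foldl (s := fun _ : α => (0, d))
    (step := fun a s x => (s.1 + 1, if s.1 = i a then x else s.2)) hl (by fun_prop) (by fun_prop)
    (Q := fun a => 1 + (4 * sz (l a) + 1) + (sz (l a) + sz d))
    (((PolyBd.const 1).add (((PolyBd.const 4).mul hl.sz_bd).add (.const 1))).add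
      (hl.sz_bd.add (.const _))) fun a l₁ l₂ e => by
        have h1 : l₁.length ≤ sz (l a) := by
          have := length_lt_sz (l a)
          simp [e] at this ⊢; omega
        have h2 := hn (0 + l₁.length)
        have h3 : sz (l₁.getD (i a) d) ≤ sz (l a) + sz d := by
          by_cases hl : i a < l₁.length
          · rw [List.getD_eq_getElem _ _ hl]
            have : l₁[i a] ∈ l a := by rw [e]; exact List.mem_append_left _ (List.getElem_mem hl)
            have := sz_le_of_mem this
            omega
          · rw [List.getD_eq_default _ _ (by omega)]; omega
        rw [hf, sz_pair]
        simp only [Nat.zero_le, if_true, Nat.sub_zero]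
        omega
  simp only [hf] at h
  simpa using h.snd

end PolyTime

/-! ### Sums and maxima over vectors of a fixed length -/

/-- The sum of `h v` over all vectors `v` of length `k` with entries smaller than `n`. -/
def vecSum : ℕ → ℕ → (List ℕ → ℕ) → ℕ
  | 0, _, h => h []
  | k + 1, n, h => ∑ i ∈ Finset.range n, vecSum k n fun v => h (i :: v)

/-- The maximum of `h v` over all vectors `v` of length `k` with entries smaller than `n`. -/
def vecSup : ℕ → ℕ → (List ℕ → ℕ) → ℕ
  | 0, _, h => h []
  | k + 1, n, h => (Finset.range n).sup fun i => vecSup k n fun v => h (i :: v)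

theorem vecSum_eq (k n : ℕ) (h : List ℕ → ℕ) :
    vecSum k n h = ∑ s ∈ Fintype.piFinset (fun _ : Fin k => Finset.range n), h (List.ofFn s) := by
  induction k generalizing h with
  | zero => simp [vecSum]
  | succ k ih =>
    simp only [vecSum, ih]
    rw [← Finset.sum_product']
    refine Finset.sum_nbij' (fun x => Fin.cons x.1 x.2) (fun s => (s 0, Fin.tail s)) ?_ ?_ ?_ ?_ ?_
    · intro x hx
      simp only [Finset.mem_product, Fintype.mem_piFinset] at hx ⊢
      exact Fin.cases hx.1 hx.2
    · intro s hs
      simp only [Finset.mem_product, Fintype.mem_piFinset] at hs ⊢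
      exact ⟨hs 0, fun i => hs i.succ⟩
    · intro x _; simp
    · intro s _; simp
    · intro x _; simp [List.ofFn_succ]

/-- Describing the maximum by its upper bounds matches `IsMaxWeight` and avoids naming a maximiser.
-/
theorem vecSup_le_iff (k n : ℕ) (h : List ℕ → ℕ) (B : ℕ) :
    vecSup k n h ≤ B ↔ ∀ s : Fin k → ℕ, (∀ i, s i < n) → h (List.ofFn s) ≤ B := by
  induction k generalizing h with
  | zero =>
    simp only [vecSup]
    exact ⟨fun hB s _ => by simpa using hB, fun hB => by simpa using hB Fin.elim0 (fun i => i.elim0)⟩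
  | succ k ih =>
    simp only [vecSup, Finset.sup_le_iff, ih, Finset.mem_range]
    constructor
    · intro hB s hs
      have := hB (s 0) (hs 0) (Fin.tail s) fun i => hs i.succ
      simpa [List.ofFn_succ] using (show h (s 0 :: List.ofFn fun i => s i.succ) ≤ B from this)
    · intro hB i hi s hs
      have := hB (Fin.cons i s) (Fin.cases hi hs)
      simpa [List.ofFn_succ] using this

namespace PolyTime

variable {α β γ δ : Type} [Enc α] [Enc β] [Enc γ] [Enc δ]

/-- Here `k` has to be a constant: it is the number of nested loops of the program. The input type
varies in the induction because the entries chosen so far become part of the input of the inner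
loops. -/
theorem vecSum (k : ℕ) {α : Type} [Enc α] {n : α → ℕ} {h : α → List ℕ → ℕ}
    (hn : PolyTime fun a => List.range (n a)) (hh : PolyTime fun x : α × List ℕ => h x.1 x.2) :
    PolyTime fun a => ShapleyMatching.vecSum k (n a) (h a) := by
  induction k generalizing α with
  | zero => exact hh.comp (f := fun a => (a, [])) (by fun_prop)
  | succ k ih =>
    exact sum_range hn (ih (n := fun x : α × ℕ => n x.1) (h := fun x v => h x.1 (x.2 :: v))
      (hn.comp (by fun_prop)) (hh.comp (f := fun x : (α × ℕ) × List ℕ => (x.1.1, x.1.2 :: x.2))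
        (by fun_prop)))

theorem vecSup (k : ℕ) {α : Type} [Enc α] {n : α → ℕ} {h : α → List ℕ → ℕ}
    (hn : PolyTime fun a => List.range (n a)) (hh : PolyTime fun x : α × List ℕ => h x.1 x.2) :
    PolyTime fun a => ShapleyMatching.vecSup k (n a) (h a) := by
  induction k generalizing α with
  | zero => exact hh.comp (f := fun a => (a, [])) (by fun_prop)
  | succ k ih =>
    exact sup_range hn (ih (n := fun x : α × ℕ => n x.1) (h := fun x v => h x.1 (x.2 :: v))
      (hn.comp (by fun_prop)) (hh.comp (f := fun x : (α × ℕ) × List ℕ => (x.1.1, x.1.2 :: x.2))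
        (by fun_prop)))

end PolyTime

/-! ### Reading instances -/

instance : Enc Γ' := ⟨fun
  | .blank => nil
  | .bit false => node nil nil
  | .bit true => node nil (node nil nil)
  | .bra => node nil (node nil (node nil nil))
  | .ket => node nil (node nil (node nil (node nil nil)))
  | .comma => node nil (node nil (node nil (node nil (node nil nil))))⟩

theorem enc_symbol_injective : Function.Injective (enc : Γ' → BTree) := by
  intro a b h
  rcases a with _ | a | _ | _ | _ <;> rcases b with _ | b | _ | _ | _ <;>
    first | rfl | (try cases a) <;> (try cases b) <;> simp_all [enc]

noncomputable instance {k : ℕ} : Enc (KPartiteInstance k) := ⟨fun I => enc (encodeInstance I.1)⟩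

/-- The state of the parser, which reads from right to left: the rows read so far, whether it is
inside an entry, the digits of the current number and those of the current denominator. -/
abbrev ParserState : Type := List (List (Bool × List Bool × List Bool)) × Bool × List Bool × List Bool

/-- One step of the parser. -/
def parseStep (g : Γ') (s : ParserState) : ParserState :=
  if g = .bit false then (s.1, s.2.1, false :: s.2.2.1, s.2.2.2)
  else if g = .bit true then (s.1, s.2.1, true :: s.2.2.1, s.2.2.2)
  else if g = .comma then
    if s.2.1 = true then (s.1, true, [], s.2.2.1) else ([] :: s.1, false, s.2.2)
  else if g = .ket then (s.1, true, [], [])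
  else if g = .bra then (((true, s.2.2.1, s.2.2.2) :: s.1.headD []) :: s.1.tail, false, [], [])
  else (((false, [], [true]) :: s.1.headD []) :: s.1.tail, s.2)

/-- Each symbol adds only a constant, so the parser state stays linear in the input, as folding
requires. -/
theorem sz_parseStep_le (g : Γ') (s : ParserState) : sz (parseStep g s) ≤ sz s + 20 := by
  obtain ⟨r, b, c, d⟩ := s
  have h1 : sz true = 3 := rfl
  have h0 : sz false = 1 := rfl
  have := one_le_sz c
  have := one_le_sz d
  have h2 : sz (r.headD []) + sz r.tail ≤ sz r + 1 := by
    cases r <;> simp; omega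
  rcases g with _ | g | _ | _ | _
  · simp [parseStep, h0, h1] at *; omega
  · cases g <;> simp [parseStep, h0, h1] at * <;> omega
  · simp [parseStep, h0, h1] at *; omega
  · simp [parseStep, h0, h1] at *; omega
  · cases b <;> simp [parseStep, h0, h1] at * <;> omega

theorem foldr_parseStep_bits (l : List Bool) (s : ParserState) :
    (l.map Γ'.bit).foldr parseStep s = (s.1, s.2.1, l ++ s.2.2.1, s.2.2.2) := by
  induction l with
  | nil => rfl
  | cons b l ih => rw [List.map_cons, List.foldr_cons, ih]; cases b <;> simp [parseStep]

open Classical in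
/-- An entry of the weighted adjacency matrix: whether it is an edge, and the numerator and the
denominator of the weight. -/
noncomputable def entry (I : Instance) (x y : Fin I.n) : Bool × ℕ × ℕ :=
  if h : I.graph.Adj x y then
    let w := I.weight ⟨s(x, y), (SimpleGraph.mem_edgeSet I.graph).2 h⟩
    (true, w.num, w.den)
  else (false, 0, 1)

/-- Read from the right, `ket` opens an entry, its inner comma moves the collected digits to the
denominator, and `bra` stores the entry in the current row. -/
theorem foldr_parseStep_entry (I : Instance) (x y : Fin I.n)
    (r : List (Bool × List Bool × List Bool)) (rs : List (List (Bool × List Bool × List Bool))) :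
    (encodeEntry I x y).foldr parseStep (r :: rs, false, [], []) =
      ((((entry I x y).1, (entry I x y).2.1.bits, (entry I x y).2.2.bits) :: r) :: rs,
        false, [], []) := by
  unfold encodeEntry entry
  by_cases h : I.graph.Adj x y
  · simp only [h, dite_true, List.foldr_append, List.foldr_cons, List.foldr_nil]
    simp only [encodeNat, encodeNat_eq_bits, foldr_parseStep_bits]
    simp [parseStep]
  · simp [h, parseStep]

/-- The weighted adjacency matrix. -/
noncomputable def matrix (I : Instance) : List (List (Bool × ℕ × ℕ)) :=
  (List.finRange I.n).map fun x => (List.finRange I.n).map fun y => entry I x y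

/-- The rows of the matrix with their numbers in binary. -/
noncomputable def bitMatrix (I : Instance) : List (List (Bool × List Bool × List Bool)) :=
  (matrix I).map fun r => r.map fun e => (e.1, e.2.1.bits, e.2.2.bits)

theorem foldr_parseStep_row (I : Instance) (x : Fin I.n) (l : List (Fin I.n))
    (r : List (Bool × List Bool × List Bool)) (rs : List (List (Bool × List Bool × List Bool))) :
    (l.flatMap fun y => encodeEntry I x y).foldr parseStep (r :: rs, false, [], []) =
      (((l.map fun y => entry I x y).map (fun e => (e.1, e.2.1.bits, e.2.2.bits)) ++ r) :: rs,
        false, [], []) := by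
  induction l with
  | nil => rfl
  | cons y l ih =>
    rw [List.flatMap_cons, List.foldr_append, ih, foldr_parseStep_entry]
    simp

theorem foldr_parseStep_rows (I : Instance) (l : List (Fin I.n)) :
    (l.flatMap fun x => ((List.finRange I.n).flatMap fun y => encodeEntry I x y) ++
      [Γ'.comma]).foldr parseStep ([], false, [], []) =
      ((l.map fun x => (List.finRange I.n).map fun y => entry I x y).map fun r =>
        r.map fun e => (e.1, e.2.1.bits, e.2.2.bits), false, [], []) := by
  induction l with
  | nil => rfl
  | cons x l ih =>
    have h : ∀ rs, parseStep .comma (rs, false, [], []) = ([] :: rs, false, [], []) := by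
      intro rs; simp [parseStep]
    rw [List.flatMap_cons, List.foldr_append, ih, List.foldr_append, List.foldr_cons,
      List.foldr_nil, h, foldr_parseStep_row]
    simp

/-- The comma after the player opens one more row, which stays empty, and the digits of the player
remain in the number register. -/
theorem foldr_parseStep (I : Instance) :
    (encodeInstance I).foldr parseStep ([], false, [], []) =
      ([] :: bitMatrix I, false, (I.player : ℕ).bits, []) := by
  have h : ∀ rs, parseStep .comma (rs, false, [], []) = ([] :: rs, false, [], []) := by
    intro rs; simp [parseStep]
  rw [encodeInstance, List.foldr_append, foldr_parseStep_rows, List.foldr_append, List.foldr_cons,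
    List.foldr_nil, h, encodeNat, encodeNat_eq_bits, foldr_parseStep_bits]
  simp [bitMatrix, matrix]

namespace PolyTime

variable {k : ℕ} {α β γ : Type} [Enc α] [Enc β] [Enc γ]

@[fun_prop]
theorem symbol_eq {f : α → Γ'} (hf : PolyTime f) (g : Γ') : PolyTime fun a => f a = g :=
  eq_const hf enc_symbol_injective g

@[fun_prop]
theorem headD_nil {l : α → List (List β)} (hl : PolyTime l) : PolyTime fun a => (l a).headD [] :=
  headD hl rfl

theorem parseStep : PolyTime fun x : Γ' × ParserState => ShapleyMatching.parseStep x.1 x.2 := by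
  unfold ShapleyMatching.parseStep
  fun_prop

theorem parsed : PolyTime fun I : KPartiteInstance k =>
    (([] :: bitMatrix I.1, false, (I.1.player : ℕ).bits, []) : ParserState) := by
  have he : PolyTime fun I : KPartiteInstance k => encodeInstance I.1 := of_enc_eq fun _ => rfl
  have hb : ∀ (s : ParserState) (l : List Γ'),
      sz (l.foldr ShapleyMatching.parseStep s) ≤ sz s + 20 * l.length := by
    intro s l
    induction l with
    | nil => simp
    | cons g l ih =>
      have := sz_parseStep_le g (l.foldr ShapleyMatching.parseStep s)
      simp only [List.foldr_cons, List.length_cons]; omega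
  have h := foldr (s := fun _ : KPartiteInstance k => (([], false, [], []) : ParserState))
    (step := fun _ g s => ShapleyMatching.parseStep g s) he (by fun_prop)
    (parseStep.comp (f := fun x : KPartiteInstance k × Γ' × ParserState => x.2) (by fun_prop))
    (Q := fun I => sz (([], false, [], []) : ParserState) + 20 * sz (encodeInstance I.1))
    ((PolyBd.const _).add ((PolyBd.const 20).mul he.sz_bd)) fun I l₁ l₂ e => by
      have h1 := length_lt_sz (encodeInstance I.1)
      rw [e, List.length_append, ← e] at h1
      exact (hb ([], false, [], []) l₂).trans (by omega)
  simpa only [foldr_parseStep] using h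

theorem player : PolyTime fun I : KPartiteInstance k => (I.1.player : ℕ) :=
  parsed.snd.snd.fst.natOf.congr_enc fun I => by simp [natOf_bits]

theorem matrix : PolyTime fun I : KPartiteInstance k => ShapleyMatching.matrix I.1 := by
  have h : PolyTime fun I : KPartiteInstance k => (bitMatrix I.1) := parsed.fst.tail
  have h' : PolyTime fun I : KPartiteInstance k =>
      (bitMatrix I.1).map fun r => r.map fun e => (e.1, natOf e.2.1, natOf e.2.2) := by
    refine map h (map (by fun_prop) (by fun_prop))
  refine h'.congr_enc fun I => ?_
  simp [bitMatrix, natOf_bits, Function.comp_def]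

theorem range_n : PolyTime fun I : KPartiteInstance k => List.range I.1.n :=
  range_of_eq matrix fun I => by simp [ShapleyMatching.matrix]

end PolyTime

open scoped NNReal

/-! ### The matching game of a complete multipartite graph -/

section

variable {V : Type*} {k : ℕ}

/-- The number of elements of `S` in each class. -/
def classCount (cls : V → Fin k) (S : Finset V) (i : Fin k) : ℕ := (S.filter fun v => cls v = i).card

/-- `x i j` edges between the classes `i` and `j` fit into a coalition with `s i` members of each
class `i`. -/
def Feasible (s : Fin k → ℕ) (x : Fin k → Fin k → ℕ) : Prop := ∀ i, ∑ j, (x i j + x j i) ≤ s i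

/-- The total weight of `x i j` edges between the classes `i` and `j`. -/
def totalWeight (w x : Fin k → Fin k → ℕ) : ℕ := ∑ i, ∑ j, x i j * w i j

/-- The matrix with a single entry `1`. -/
def unitMatrix (a b : Fin k) (i j : Fin k) : ℕ := if i = a ∧ j = b then 1 else 0

theorem sum_unitMatrix (a b i : Fin k) :
    ∑ j, (unitMatrix a b i j + unitMatrix a b j i) =
      (if a = i then 1 else 0) + if b = i then 1 else 0 := by
  rw [Finset.sum_add_distrib]
  congr 1
  · by_cases h : i = a
    · simp [unitMatrix, h]
    · simp [unitMatrix, h, Ne.symm h]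
  · by_cases h : i = b
    · simp [unitMatrix, h]
    · simp [unitMatrix, h, Ne.symm h]

theorem totalWeight_unitMatrix (w : Fin k → Fin k → ℕ) (a b : Fin k) :
    totalWeight w (unitMatrix a b) = w a b := by
  unfold totalWeight unitMatrix
  rw [Finset.sum_eq_single a, Finset.sum_eq_single b]
  · simp
  · intro j _ h; simp [h]
  · simp
  · intro i _ h; simp [h]
  · simp

theorem totalWeight_add (w x y : Fin k → Fin k → ℕ) :
    totalWeight w (fun i j => x i j + y i j) = totalWeight w x + totalWeight w y := by
  simp only [totalWeight, add_mul, Finset.sum_add_distrib]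

open Classical in
theorem classCount_sdiff (cls : V → Fin k) (S : Finset V) {a b : V} (ha : a ∈ S) (hb : b ∈ S)
    (hab : a ≠ b) (i : Fin k) :
    classCount cls S i = classCount cls (S \ {a, b}) i +
      ((if cls a = i then 1 else 0) + if cls b = i then 1 else 0) := by
  have h1 : S = insert a (insert b (S \ {a, b})) := by
    ext v
    by_cases h1 : v = a <;> by_cases h2 : v = b <;> simp_all
  conv_lhs => rw [h1]
  simp only [classCount, Finset.card_filter]
  rw [Finset.sum_insert (by simp [hab]), Finset.sum_insert (by simp)]
  ring

variable (G : WeightedGraph V) (cls : V → Fin k) (w : Fin k → Fin k → ℕ) (D : ℕ)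

/-- The weights of the edges of `G` are the natural numbers `w` divided by `D`. -/
structure IsScaled : Prop where
  adj_iff : ∀ x y, G.graph.Adj x y ↔ cls x ≠ cls y
  weight_mul : ∀ x y (h : G.graph.Adj x y),
    G.weight ⟨s(x, y), (SimpleGraph.mem_edgeSet G.graph).2 h⟩ * D = w (cls x) (cls y)
  weight_self : ∀ i, w i i = 0
  pos : 0 < D

variable {G cls w D}

/-- Count the edges of the matching by the classes of their ends. In the induction, an edge is
removed together with its two ends, which the remaining edges avoid. -/
theorem IsScaled.exists_feasible (hG : IsScaled G cls w D) (M : Finset G.graph.edgeSet)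
    (S : Finset V) (hM : G.IsMatching M) (hS : G.EdgesWithin M S) :
    ∃ x, Feasible (classCount cls S) x ∧ (totalWeight w x : ℝ≥0) = (∑ e ∈ M, G.weight e) * D := by
  classical
  induction M using Finset.induction_on generalizing S with
  | empty => exact ⟨fun _ _ => 0, fun i => by simp, by simp [totalWeight]⟩
  | insert e M he ih =>
    obtain ⟨⟨a, b⟩, h⟩ := e
    have hadj : G.graph.Adj a b := h
    have ha : a ∈ S := hS _ (Finset.mem_insert_self _ _) a (Sym2.mem_mk_left a b)
    have hb : b ∈ S := hS _ (Finset.mem_insert_self _ _) b (Sym2.mem_mk_right a b)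
    obtain ⟨x, hx, hw⟩ := ih (S \ {a, b})
      (fun e he f hf => hM e (Finset.mem_insert_of_mem he) f (Finset.mem_insert_of_mem hf))
      (fun f hf v hv => by
        have hne : (⟨s(a, b), h⟩ : G.graph.edgeSet) ≠ f := fun h => he (h ▸ hf)
        have hd := hM _ (Finset.mem_insert_self _ _) f (Finset.mem_insert_of_mem hf) hne v
        have hvS := hS f (Finset.mem_insert_of_mem hf) v hv
        simp only [Finset.mem_sdiff, Finset.mem_insert, Finset.mem_singleton]
        refine ⟨hvS, ?_⟩
        rintro (rfl | rfl)
        · exact hd ⟨Sym2.mem_mk_left _ _, hv⟩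
        · exact hd ⟨Sym2.mem_mk_right _ _, hv⟩)
    refine ⟨fun i j => x i j + unitMatrix (cls a) (cls b) i j, fun i => ?_, ?_⟩
    · rw [classCount_sdiff cls S ha hb hadj.ne i, ← sum_unitMatrix]
      refine le_trans (le_of_eq ?_) (Nat.add_le_add_right (hx i) _)
      rw [← Finset.sum_add_distrib]
      exact Finset.sum_congr rfl fun j _ => by ring
    · rw [totalWeight_add, totalWeight_unitMatrix, Finset.sum_insert he, add_mul, Nat.cast_add, hw,
        ← hG.weight_mul a b hadj, add_comm]

/-- Greedy construction, by induction on the number of prescribed edges: feasibility leaves an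
unused vertex in each of two different classes with a positive entry, and any such pair is an edge
of the right weight. -/
theorem IsScaled.exists_matching (hG : IsScaled G cls w D) (x : Fin k → Fin k → ℕ) (S : Finset V)
    (hx : Feasible (classCount cls S) x) :
    ∃ M : Finset G.graph.edgeSet, G.IsMatching M ∧ G.EdgesWithin M S ∧
      (totalWeight w x : ℝ≥0) = (∑ e ∈ M, G.weight e) * D := by
  classical
  induction hn : ∑ i, ∑ j, x i j using Nat.strong_induction_on generalizing x S with
  | _ n ih =>
  subst hn
  by_cases h0 : ∀ i j, x i j = 0
  · refine ⟨∅, ?_, ?_, ?_⟩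
    · intro e he; simp at he
    · intro e he; simp at he
    · simp [totalWeight, h0]
  push Not at h0
  obtain ⟨i, j, hij⟩ := h0
  set y : Fin k → Fin k → ℕ := fun a b => x a b - unitMatrix i j a b with hy
  have hxy : x = fun a b => y a b + unitMatrix i j a b := by
    funext a b
    simp only [hy, unitMatrix]
    split_ifs with h
    · obtain ⟨rfl, rfl⟩ := h; omega
    · rfl
  have hsum : ∑ a, ∑ b, y a b < ∑ a, ∑ b, x a b := by
    refine Finset.sum_lt_sum (fun a _ => Finset.sum_le_sum fun b _ => Nat.sub_le _ _)
      ⟨i, Finset.mem_univ _, Finset.sum_lt_sum (fun b _ => Nat.sub_le _ _)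
        ⟨j, Finset.mem_univ _, ?_⟩⟩
    simp [hy, unitMatrix]; omega
  have hfeas : ∀ a, ∑ b, (y a b + y b a) + ((if i = a then 1 else 0) + if j = a then 1 else 0) ≤
      classCount cls S a := by
    intro a
    refine le_trans (le_of_eq ?_) (hx a)
    rw [← sum_unitMatrix, ← Finset.sum_add_distrib]
    conv_rhs => rw [hxy]
    exact Finset.sum_congr rfl fun b _ => by ring
  have hval : totalWeight w x = totalWeight w y + w i j := by
    rw [← totalWeight_unitMatrix w i j, ← totalWeight_add, ← hxy]
  -- A diagonal entry corresponds to no edge, but it has weight zero and can be dropped.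
  by_cases hne : i = j
  · subst hne
    obtain ⟨M, h1, h2, h3⟩ := ih _ hsum y S (fun a => le_trans (Nat.le_add_right _ _) (hfeas a)) rfl
    exact ⟨M, h1, h2, by rw [hval, hG.weight_self, add_zero, h3]⟩
  · have hi := hfeas i
    have hj := hfeas j
    simp only [if_true, if_neg hne, if_neg (Ne.symm hne)] at hi hj
    have hcard : ∀ c, 0 < classCount cls S c → ∃ v ∈ S, cls v = c := by
      intro c hc
      obtain ⟨v, hv⟩ := Finset.card_pos.1 hc
      exact ⟨v, (Finset.mem_filter.1 hv).1, (Finset.mem_filter.1 hv).2⟩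
    obtain ⟨a, ha, rfl⟩ := hcard i (by omega)
    obtain ⟨b, hb, rfl⟩ := hcard j (by omega)
    have hadj : G.graph.Adj a b := (hG.adj_iff a b).2 hne
    obtain ⟨M, h1, h2, h3⟩ := ih _ hsum y (S \ {a, b}) (fun c => by
      have := hfeas c
      rw [classCount_sdiff cls S ha hb hadj.ne c] at this
      omega) rfl
    have hout : ∀ f ∈ M, ∀ v ∈ (f : Sym2 V), v ≠ a ∧ v ≠ b := by
      intro f hf v hv
      have := h2 f hf v hv
      simp only [Finset.mem_sdiff, Finset.mem_insert, Finset.mem_singleton, not_or] at this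
      exact this.2
    have he : (⟨s(a, b), hadj⟩ : G.graph.edgeSet) ∉ M := fun h =>
      (hout _ h a (Sym2.mem_mk_left a b)).1 rfl
    have hedge : ∀ f ∈ M, ∀ v, ¬ (v ∈ s(a, b) ∧ v ∈ (f : Sym2 V)) := by
      rintro f hf v ⟨hv, hv'⟩
      rcases Sym2.mem_iff.1 hv with rfl | rfl
      · exact (hout f hf _ hv').1 rfl
      · exact (hout f hf _ hv').2 rfl
    refine ⟨insert ⟨s(a, b), hadj⟩ M, ?_, ?_, ?_⟩
    · intro e he f hf hef v
      rcases Finset.mem_insert.1 he with rfl | he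
      · rcases Finset.mem_insert.1 hf with rfl | hf
        · exact absurd rfl hef
        · exact hedge f hf v
      · rcases Finset.mem_insert.1 hf with rfl | hf
        · exact fun h => hedge e he v h.symm
        · exact h1 e he f hf hef v
    · intro e he v hv
      rcases Finset.mem_insert.1 he with rfl | he
      · rcases Sym2.mem_iff.1 hv with rfl | rfl
        · exact ha
        · exact hb
      · exact (Finset.mem_sdiff.1 (h2 e he v hv)).1
    · rw [Finset.sum_insert he, add_mul, hval, Nat.cast_add, h3, ← hG.weight_mul a b hadj, add_comm]

/-- `F` is the maximum of the total weights of the feasible edge counts. -/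
def IsMaxWeight (w : Fin k → Fin k → ℕ) (s : Fin k → ℕ) (F : ℕ) : Prop :=
  ∀ B, F ≤ B ↔ ∀ x, Feasible s x → totalWeight w x ≤ B

theorem IsMaxWeight.mono {s s' : Fin k → ℕ} {F F' : ℕ} (h : IsMaxWeight w s F)
    (h' : IsMaxWeight w s' F') (hs : ∀ i, s i ≤ s' i) : F ≤ F' :=
  (h F').2 fun x hx => (h' F').1 le_rfl x fun i => (hx i).trans (hs i)

theorem IsScaled.matchingGame_mul [Fintype V] (hG : IsScaled G cls w D) (S : Finset V) {F : ℕ}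
    (hF : IsMaxWeight w (classCount cls S) F) : G.matchingGame S * D = F := by
  classical
  unfold WeightedGraph.matchingGame
  rw [← NNReal.coe_natCast D, ← NNReal.coe_mul, ← NNReal.coe_natCast F]
  congr 1
  have hD : (0 : ℝ≥0) < D := by exact_mod_cast hG.pos
  apply le_antisymm
  · rw [← le_div_iff₀ hD, Finset.sup_le_iff]
    intro M hM
    simp only [Finset.mem_filter, Finset.mem_univ, true_and] at hM
    obtain ⟨x, hx, hw⟩ := hG.exists_feasible M S hM.1 hM.2
    rw [le_div_iff₀ hD, ← hw]
    exact_mod_cast (hF F).1 le_rfl x hx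
  -- `hF` compares with natural bounds only, so the floor of the scaled worth is used. Total weights
  -- are natural numbers, so nothing is lost.
  · refine le_trans (Nat.cast_le.2 ((hF _).2 fun x hx => ?_)) (Nat.floor_le zero_le)
    obtain ⟨M, h1, h2, h3⟩ := hG.exists_matching x S hx
    refine Nat.le_floor ?_
    rw [h3]
    refine mul_le_mul_left ?_ _
    exact Finset.le_sup (f := fun M => ∑ e ∈ M, G.weight e)
      (Finset.mem_filter.2 ⟨Finset.mem_univ _, h1, h2⟩)

/-! ### Counting coalitions -/

theorem classCount_sum (cls : V → Fin k) (S : Finset V) : ∑ i, classCount cls S i = S.card :=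
  (Finset.card_eq_sum_card_fiberwise (f := cls) (t := Finset.univ) (by simp)).symm

open Classical in
-- A subset is determined by its intersections with the classes, and these can be chosen
-- independently.
theorem card_filter_classCount (cls : V → Fin k) (T : Finset V) (s : Fin k → ℕ) :
    (T.powerset.filter fun S => classCount cls S = s).card = ∏ i, (classCount cls T i).choose (s i) := by
  have h : ∏ i, (classCount cls T i).choose (s i) =
      (Fintype.piFinset fun i => (T.filter fun v => cls v = i).powersetCard (s i)).card := by
    rw [Fintype.card_piFinset]
    simp [classCount]
  rw [h]
  refine Finset.card_nbij' (fun S i => S.filter fun v => cls v = i)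
    (fun g => Finset.univ.biUnion g) ?_ ?_ ?_ ?_
  · intro S hS
    simp only [Finset.coe_filter, Finset.mem_powerset, Set.mem_ofPred_eq] at hS
    simp only [Finset.mem_coe, Fintype.mem_piFinset, Finset.mem_powersetCard]
    exact fun i => ⟨Finset.filter_subset_filter _ hS.1, congrFun hS.2 i⟩
  · intro g hg
    simp only [Finset.mem_coe, Fintype.mem_piFinset, Finset.mem_powersetCard] at hg
    simp only [Finset.coe_filter, Finset.mem_powerset, Set.mem_ofPred_eq]
    refine ⟨fun v hv => ?_, ?_⟩
    · obtain ⟨i, _, hi⟩ := Finset.mem_biUnion.1 hv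
      exact (Finset.mem_filter.1 ((hg i).1 hi)).1
    · funext i
      rw [← (hg i).2, classCount]
      congr 1
      ext v
      simp only [Finset.mem_filter, Finset.mem_biUnion, Finset.mem_univ, true_and]
      constructor
      · rintro ⟨⟨j, hj⟩, hv⟩
        have := (Finset.mem_filter.1 ((hg j).1 hj)).2
        rwa [← hv, this]
      · intro hv
        exact ⟨⟨i, hv⟩, (Finset.mem_filter.1 ((hg i).1 hv)).2⟩
  · intro S _
    ext v
    simp
  · intro g hg
    simp only [Finset.mem_coe, Fintype.mem_piFinset, Finset.mem_powersetCard] at hg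
    funext i
    ext v
    simp only [Finset.mem_filter, Finset.mem_biUnion, Finset.mem_univ, true_and]
    constructor
    · rintro ⟨⟨j, hj⟩, hv⟩
      have := (Finset.mem_filter.1 ((hg j).1 hj)).2
      rwa [← hv, this]
    · intro hv
      exact ⟨⟨i, hv⟩, (Finset.mem_filter.1 ((hg i).1 hv)).2⟩

theorem sum_powerset_classCount (cls : V → Fin k) (T : Finset V) (n : ℕ) (hT : T.card < n)
    (h : (Fin k → ℕ) → ℝ) :
    ∑ S ∈ T.powerset, h (classCount cls S) =
      ∑ s ∈ Fintype.piFinset (fun _ : Fin k => Finset.range n),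
        (∏ i, (classCount cls T i).choose (s i) : ℕ) * h s := by
  classical
  rw [← Finset.sum_fiberwise_of_maps_to (s := T.powerset) (g := classCount cls)
    (t := Fintype.piFinset (fun _ : Fin k => Finset.range n))]
  · refine Finset.sum_congr rfl fun s _ => ?_
    rw [← card_filter_classCount, ← nsmul_eq_mul, ← Finset.sum_const]
    exact Finset.sum_congr rfl fun S hS => by rw [(Finset.mem_filter.1 hS).2]
  · intro S hS
    simp only [Fintype.mem_piFinset, Finset.mem_range]
    intro i
    exact ((Finset.card_filter_le _ _).trans (Finset.card_le_card (Finset.mem_powerset.1 hS))).trans_lt hT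

/-- Size and marginal contribution depend only on the class counts, so coalitions are grouped by
them. The argument `e` of `F` says whether the player has been added to its class. -/
theorem IsScaled.rawShapleyValue_mul [Fintype V] [DecidableEq V] (hG : IsScaled G cls w D) (v : V)
    (F : (Fin k → ℕ) → ℕ → ℕ)
    (hF : ∀ s e, (∀ i, s i < Fintype.card V) → e ≤ 1 →
      IsMaxWeight w (fun i => s i + if i = cls v then e else 0) (F s e))
    (a : Fin k → ℕ) (ha : ∀ i, a i = (Finset.univ.filter fun u => u ≠ v ∧ cls u = i).card) :
    G.matchingGame.rawShapleyValue v * D =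
      (∑ s ∈ Fintype.piFinset (fun _ : Fin k => Finset.range (Fintype.card V)),
        (∏ i, (a i).choose (s i)) * ((∑ i, s i).factorial *
          (Fintype.card V - ∑ i, s i - 1).factorial * (F s 1 - F s 0)) : ℕ) := by
  classical
  have ha' : a = classCount cls (Finset.univ.erase v) := by
    funext i
    rw [ha, classCount]
    congr 1
    ext u
    simp
  have hcard : (Finset.univ.erase v).card < Fintype.card V :=
    Finset.card_erase_lt_of_mem (Finset.mem_univ v)
  have key := sum_powerset_classCount cls (Finset.univ.erase v) _ hcard
    fun s => (((∑ i, s i).factorial * (Fintype.card V - ∑ i, s i - 1).factorial *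
      (F s 1 - F s 0) : ℕ) : ℝ)
  rw [Nat.cast_sum, ha']
  simp only [Nat.cast_mul (∏ i, (classCount cls (Finset.univ.erase v) i).choose _)]
  rw [← key, CoopGame.rawShapleyValue, Finset.sum_mul]
  refine Finset.sum_congr (by congr!) fun S hS => ?_
  have hvS : v ∉ S := fun h => by
    have := Finset.mem_powerset.1 hS h
    simp at this
  have hS' : ∀ i, classCount cls S i < Fintype.card V := fun i =>
    ((Finset.card_filter_le _ _).trans (Finset.card_le_card (by simpa using hS))).trans_lt hcard
  have h1 := hG.matchingGame_mul (insert v S) (F := F (classCount cls S) 1) (by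
    convert hF (classCount cls S) 1 hS' le_rfl using 1
    funext i
    simp only [classCount, Finset.filter_insert, eq_comm (a := i)]
    split_ifs with h
    · rw [Finset.card_insert_of_notMem (by simp [hvS])]
    · rfl)
  have h0 := hG.matchingGame_mul S (F := F (classCount cls S) 0) (by
    convert hF (classCount cls S) 0 hS' zero_le_one using 1
    funext i
    simp)
  -- Monotonicity makes the truncated difference of naturals agree with the real one.
  have hmono : F (classCount cls S) 0 ≤ F (classCount cls S) 1 :=
    (hF _ 0 hS' zero_le_one).mono (hF _ 1 hS' le_rfl) fun i => by split_ifs <;> omega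
  rw [classCount_sum, Nat.cast_mul, Nat.cast_mul, Nat.cast_sub hmono, ← h1, ← h0]
  have : (insert v S : Finset V) = @insert V (Finset V)
    (@Finset.instInsert V fun a b => Classical.propDecidable (a = b)) v S := by congr!
  rw [this]
  ring

/-! ### Binomial coefficients without division -/

/-- The quotient `a! / s!`. -/
def fall (a s : ℕ) : ℕ := ∏ t ∈ Finset.range a, if s ≤ t then t + 1 else 1

theorem fall_mul_factorial {a s : ℕ} (h : s ≤ a) : fall a s * s.factorial = a.factorial := by
  induction a, h using Nat.le_induction with
  | base =>
    rw [fall, Finset.prod_eq_one, one_mul]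
    intro t ht
    rw [if_neg (by have := Finset.mem_range.1 ht; omega)]
  | succ a h ih =>
    have : fall (a + 1) s = fall a s * (a + 1) := by
      rw [fall, Finset.prod_range_succ, if_pos h, fall]
    rw [this, Nat.factorial_succ, ← ih]
    ring

theorem fall_zero (a : ℕ) : fall a 0 = a.factorial := by
  simpa using fall_mul_factorial (Nat.zero_le a)

/-- This gives a binomial coefficient as a product, up to the factor `a.factorial`, which does not
depend on `s` and can be moved to the denominator of the final answer. -/
theorem fall_mul_fall {a s : ℕ} (h : s ≤ a) :
    fall a s * fall a (a - s) = a.choose s * a.factorial := by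
  have h1 := fall_mul_factorial h
  have h2 := fall_mul_factorial (Nat.sub_le a s)
  have h3 := Nat.choose_mul_factorial_mul_factorial h
  have hp : 0 < s.factorial * (a - s).factorial :=
    Nat.mul_pos (Nat.factorial_pos _) (Nat.factorial_pos _)
  refine Nat.eq_of_mul_eq_mul_right hp ?_
  calc fall a s * fall a (a - s) * (s.factorial * (a - s).factorial)
      = (fall a s * s.factorial) * (fall a (a - s) * (a - s).factorial) := by ring
    _ = a.factorial * a.factorial := by rw [h1, h2]
    _ = (a.choose s * s.factorial * (a - s).factorial) * a.factorial := by rw [h3]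
    _ = _ := by ring

end

/-! ### The classes of a complete multipartite graph -/

/-- The number of those classes of the complete multipartite graph `A` on `0, …, n - 1` whose least
element is smaller than all elements of the class of `y`. -/
def classIndex (n : ℕ) (A : ℕ → ℕ → Prop) [∀ x y, Decidable (A x y)] (y : ℕ) : ℕ :=
  ((Finset.range n).filter fun z =>
    (∀ u < n, u < z → A u z) ∧ ∀ u < n, ¬ A u y → z < u).card

section

variable {n k : ℕ} {A : ℕ → ℕ → Prop} [∀ x y, Decidable (A x y)] {part : ℕ → Fin k}

/-- The vertices counted are minima of pairwise different classes, and none lies in the class of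
`y`, whose minimum is not smaller than itself. So they inject into the parts other than that of `y`.
-/
theorem classIndex_lt (hA : ∀ x < n, ∀ y < n, A x y ↔ part x ≠ part y) {y : ℕ} (hy : y < n) :
    classIndex n A y < k := by
  have hc : (Finset.univ.erase (part y)).card < k := by
    have := Finset.card_erase_lt_of_mem (Finset.mem_univ (part y))
    simpa using this
  refine lt_of_le_of_lt (Finset.card_le_card_of_injOn part ?_ ?_) hc
  · intro z hz
    simp only [Finset.coe_filter, Finset.mem_range, Set.mem_ofPred_eq] at hz
    simp only [Finset.coe_erase, Finset.coe_univ, Set.mem_sdiff, Set.mem_univ, true_and,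
      Set.mem_singleton_iff]
    intro h
    exact lt_irrefl z (hz.2.2 z hz.1 (by rw [hA z hz.1 y hy]; simpa using h))
  · intro z hz z' hz' h
    simp only [Finset.coe_filter, Finset.mem_range, Set.mem_ofPred_eq] at hz hz'
    rcases lt_trichotomy z z' with hlt | rfl | hlt
    · exact absurd h ((hA z hz.1 z' hz'.1).1 (hz'.2.1 z hz.1 hlt))
    · rfl
    · exact absurd h.symm ((hA z' hz'.1 z hz.1).1 (hz.2.1 z' hz'.1 hlt))

/-- Distinct classes have distinct minima. If the minimum `m` of one is smaller, then everything
counted for it is counted for the other, and so is `m` itself. -/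
theorem classIndex_eq_iff (hA : ∀ x < n, ∀ y < n, A x y ↔ part x ≠ part y) {x y : ℕ} (hx : x < n)
    (hy : y < n) : classIndex n A x = classIndex n A y ↔ part x = part y := by
  classical
  have hmin : ∀ x < n, ∃ m < n, part m = part x ∧ ∀ u < n, part u = part x → m ≤ u := by
    intro x hx
    have hex : ∃ m, m < n ∧ part m = part x := ⟨x, hx, rfl⟩
    exact ⟨Nat.find hex, (Nat.find_spec hex).1, (Nat.find_spec hex).2,
      fun u hu hp => Nat.find_min' hex ⟨hu, hp⟩⟩
  have hlt : ∀ x < n, ∀ y < n, ∀ m m', m < n → part m = part x →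
      (∀ u < n, part u = part x → m ≤ u) → (∀ u < n, part u = part y → m' ≤ u) → m < m' →
      classIndex n A x < classIndex n A y := by
    intro x hx y hy m m' hm hmx hmin hmin' hmm
    refine Finset.card_lt_card (Finset.ssubset_iff_of_subset ?_ |>.2 ⟨m, ?_, ?_⟩)
    · intro z hz
      simp only [Finset.mem_filter, Finset.mem_range] at hz ⊢
      refine ⟨hz.1, hz.2.1, fun u hu huy => ?_⟩
      have h1 := hz.2.2 m hm (by rw [hA m hm x hx]; simpa using hmx)
      have h2 := hmin' u hu (by rw [hA u hu y hy] at huy; simpa using huy)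
      omega
    · simp only [Finset.mem_filter, Finset.mem_range]
      refine ⟨hm, fun u hu hum => ?_, fun u hu huy => ?_⟩
      · rw [hA u hu m hm, hmx]
        intro h
        have := hmin u hu h
        omega
      · have h2 := hmin' u hu (by rw [hA u hu y hy] at huy; simpa using huy)
        omega
    · simp only [Finset.mem_filter, Finset.mem_range]
      rintro ⟨_, _, h⟩
      exact lt_irrefl m (h m hm (by rw [hA m hm x hx]; simpa using hmx))
  constructor
  · intro h
    by_contra hne
    obtain ⟨m, hm, hmx, hmm⟩ := hmin x hx
    obtain ⟨m', hm', hmy, hmm'⟩ := hmin y hy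
    rcases lt_trichotomy m m' with hl | rfl | hl
    · exact absurd h (hlt x hx y hy m m' hm hmx hmm hmm' hl).ne
    · exact hne (hmx.symm.trans hmy)
    · exact absurd h.symm (hlt y hy x hx m' m hm' hmy hmm' hmm hl).ne
  · intro h
    unfold classIndex
    congr 1
    ext z
    simp only [Finset.mem_filter, Finset.mem_range]
    have : ∀ u < n, (¬ A u x ↔ ¬ A u y) := fun u hu => by rw [hA u hu x hx, hA u hu y hy, h]
    constructor
    · exact fun hz => ⟨hz.1, hz.2.1, fun u hu huy => hz.2.2 u hu ((this u hu).2 huy)⟩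
    · exact fun hz => ⟨hz.1, hz.2.1, fun u hu huy => hz.2.2 u hu ((this u hu).1 huy)⟩

end

/-! ### The algorithm -/

section

variable {k : ℕ} (I : KPartiteInstance k)

/-- The entry at given positions of the matrix. -/
noncomputable def entryAt (x y : ℕ) : Bool × ℕ × ℕ :=
  ((matrix I.1).getD x []).getD y (false, 0, 1)

/-- The index of the class of a vertex. -/
noncomputable def classOf (y : ℕ) : ℕ := classIndex I.1.n (fun x y => (entryAt I x y).1 = true) y

/-- A common denominator of all weights. -/
noncomputable def commonDen : ℕ :=
  ∏ x ∈ Finset.range I.1.n, ∏ y ∈ Finset.range I.1.n, (entryAt I x y).2.2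

/-- The weights multiplied by the common denominator. -/
noncomputable def scaledWeight (x y : ℕ) : ℕ :=
  ∏ x' ∈ Finset.range I.1.n, ∏ y' ∈ Finset.range I.1.n,
    if x' = x ∧ y' = y then (entryAt I x' y').2.1 else (entryAt I x' y').2.2

/-- The scaled weight of the edges between two classes. -/
noncomputable def classWeight (i j : ℕ) : ℕ :=
  (Finset.range I.1.n).sup fun x => (Finset.range I.1.n).sup fun y =>
    if classOf I x = i ∧ classOf I y = j then scaledWeight I x y else 0

/-- The number of vertices in a class, not counting the player. -/
noncomputable def classSize (i : ℕ) : ℕ :=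
  ((Finset.range I.1.n).filter fun y : ℕ => y ≠ (I.1.player : ℕ) ∧ classOf I y = i).card

/-- The scaled value of a coalition with class counts `s`, and `e` further members of class `c`. -/
noncomputable def coalitionValue (s : List ℕ) (c e : ℕ) : ℕ :=
  vecSup (k * k) (I.1.n + 1) fun x =>
    if ∀ i < k, ∑ j ∈ Finset.range k, (x.getD (j + k * i) 0 + x.getD (i + k * j) 0) ≤
      s.getD i 0 + if i = c then e else 0
    then ∑ i ∈ Finset.range k, ∑ j ∈ Finset.range k, x.getD (j + k * i) 0 * classWeight I i j
    else 0

/-- The quotient `a! / s!` for `a ≤ n`. -/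
def boundedFall (n a s : ℕ) : ℕ := ∏ t ∈ Finset.range n, if s ≤ t ∧ t < a then t + 1 else 1

/-- The numerator of the Shapley value. -/
noncomputable def shapleyNum : ℕ :=
  vecSum k I.1.n fun s =>
    if ∀ i < k, s.getD i 0 ≤ classSize I i then
      (∏ i ∈ Finset.range k, boundedFall I.1.n (classSize I i) (s.getD i 0) *
        boundedFall I.1.n (classSize I i) (classSize I i - s.getD i 0)) *
      (boundedFall I.1.n (∑ i ∈ Finset.range k, s.getD i 0) 0 *
        boundedFall I.1.n (I.1.n - (∑ i ∈ Finset.range k, s.getD i 0) - 1) 0 *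
        (coalitionValue I s (classOf I I.1.player) 1 - coalitionValue I s (classOf I I.1.player) 0))
    else 0

/-- The denominator of the Shapley value. -/
noncomputable def shapleyDen : ℕ :=
  commonDen I * (boundedFall I.1.n I.1.n 0 *
    ∏ i ∈ Finset.range k, boundedFall I.1.n (classSize I i) 0)

end

namespace PolyTime

variable {k : ℕ} {α β : Type} [Enc α] [Enc β] {I : α → KPartiteInstance k}

theorem range_inst (hI : PolyTime I) : PolyTime fun a => List.range (I a).1.n := range_n.comp hI

@[fun_prop]
theorem n_inst (hI : PolyTime I) : PolyTime fun a => (I a).1.n := of_range (range_inst hI)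

@[fun_prop]
theorem entryAt (hI : PolyTime I) {x y : α → ℕ} (hx : PolyTime x) (hy : PolyTime y) :
    PolyTime fun a => ShapleyMatching.entryAt (I a) (x a) (y a) := by
  have : PolyTime fun a => ShapleyMatching.matrix (I a).1 := matrix.comp hI
  unfold ShapleyMatching.entryAt
  fun_prop

@[fun_prop]
theorem classOf (hI : PolyTime I) {y : α → ℕ} (hy : PolyTime y) :
    PolyTime fun a => ShapleyMatching.classOf (I a) (y a) := by
  unfold ShapleyMatching.classOf classIndex
  refine card_filter_range (range_inst hI) (and ?_ ?_)
  · have : PolyTime fun x : (α × ℕ) × ℕ => ¬ x.2 < x.1.2 ∨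
      (ShapleyMatching.entryAt (I x.1.1) x.2 x.1.2).1 = true := by fun_prop
    exact forall_lt (range_inst (by fun_prop)) (this.prop_congr fun _ => imp_iff_not_or)
  · have : PolyTime fun x : (α × ℕ) × ℕ => ¬ ¬ (ShapleyMatching.entryAt (I x.1.1) x.2 (y x.1.1)).1 = true
      ∨ x.1.2 < x.2 := by fun_prop
    exact forall_lt (range_inst (by fun_prop)) (this.prop_congr fun _ => imp_iff_not_or)

@[fun_prop]
theorem commonDen (hI : PolyTime I) : PolyTime fun a => ShapleyMatching.commonDen (I a) :=
  prod_range (range_inst hI) (prod_range (range_inst (by fun_prop)) (by fun_prop))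

@[fun_prop]
theorem scaledWeight (hI : PolyTime I) {x y : α → ℕ} (hx : PolyTime x) (hy : PolyTime y) :
    PolyTime fun a => ShapleyMatching.scaledWeight (I a) (x a) (y a) :=
  prod_range (range_inst hI) (prod_range (range_inst (by fun_prop)) (by fun_prop))

@[fun_prop]
theorem classWeight (hI : PolyTime I) {x y : α → ℕ} (hx : PolyTime x) (hy : PolyTime y) :
    PolyTime fun a => ShapleyMatching.classWeight (I a) (x a) (y a) :=
  sup_range (range_inst hI) (sup_range (range_inst (by fun_prop)) (by fun_prop))

@[fun_prop]
theorem player_inst (hI : PolyTime I) : PolyTime fun a => ((I a).1.player : ℕ) := player.comp hI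

@[fun_prop]
theorem classSize (hI : PolyTime I) {y : α → ℕ} (hy : PolyTime y) :
    PolyTime fun a => ShapleyMatching.classSize (I a) (y a) :=
  card_filter_range (range_inst hI) (and (by fun_prop) (by fun_prop))

@[fun_prop]
theorem coalitionValue (hI : PolyTime I) {s : α → List ℕ} {c e : α → ℕ} (hs : PolyTime s)
    (hc : PolyTime c) (he : PolyTime e) :
    PolyTime fun a => ShapleyMatching.coalitionValue (I a) (s a) (c a) (e a) := by
  refine vecSup (k * k) (range_succ (range_inst hI)) (ite ?_ ?_ (const 0))
  · exact forall_lt (range_const k) (le (sum_range (range_const k) (by fun_prop)) (by fun_prop))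
  · exact sum_range (range_const k) (sum_range (range_const k) (by fun_prop))

@[fun_prop]
theorem boundedFall (hI : PolyTime I) {x y : α → ℕ} (hx : PolyTime x) (hy : PolyTime y) :
    PolyTime fun a => ShapleyMatching.boundedFall (I a).1.n (x a) (y a) :=
  prod_range (range_inst hI) (by fun_prop)

theorem shapleyNum : PolyTime fun I : KPartiteInstance k => ShapleyMatching.shapleyNum I := by
  refine vecSum k range_n (ite ?_ ?_ (const 0))
  · exact forall_lt (range_const k) (by fun_prop)
  · have h : PolyTime fun x : KPartiteInstance k × List ℕ => ∑ i ∈ Finset.range k, x.2.getD i 0 :=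
      sum_range (range_const k) (by fun_prop)
    refine mul (prod_range (range_const k) (mul ?_ ?_)) (mul (mul ?_ ?_) (sub ?_ ?_))
    · exact boundedFall (by fun_prop) (by fun_prop) (by fun_prop)
    · exact boundedFall (by fun_prop) (by fun_prop) (by fun_prop)
    · exact boundedFall (by fun_prop) h (by fun_prop)
    · exact boundedFall (by fun_prop) (by fun_prop) (by fun_prop)
    · fun_prop
    · fun_prop

theorem shapleyDen : PolyTime fun I : KPartiteInstance k => ShapleyMatching.shapleyDen I :=
  mul (by fun_prop) (mul (boundedFall (by fun_prop) (by fun_prop) (by fun_prop))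
    (prod_range (range_const k) (boundedFall (by fun_prop) (by fun_prop) (by fun_prop))))

end PolyTime

/-! ### Correctness -/

section

variable {k : ℕ} (I : KPartiteInstance k)

theorem entryAt_coe (x y : Fin I.1.n) : entryAt I x y = entry I.1 x y := by
  simp [entryAt, matrix]

theorem entry_fst (x y : Fin I.1.n) : (entry I.1 x y).1 = true ↔ I.1.graph.Adj x y := by
  by_cases h : I.1.graph.Adj x y <;> simp [entry, h]

theorem entry_den_pos (x y : Fin I.1.n) : 0 < (entry I.1 x y).2.2 := by
  by_cases h : I.1.graph.Adj x y <;> simp [entry, h, NNRat.den_pos]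

/-- A partition of the vertices, extended to all natural numbers. -/
noncomputable def partOf (x : ℕ) : Fin k :=
  if h : x < I.1.n then Classical.choose I.2 ⟨x, h⟩ else Classical.choose I.2 I.1.player

theorem adj_iff_partOf (x y : Fin I.1.n) : I.1.graph.Adj x y ↔ partOf I x ≠ partOf I y := by
  have h := (Classical.choose_spec I.2).1 x y
  change I.1.graph.Adj x y ↔ _ at h
  simpa [partOf] using h

theorem weight_eq_of_partOf {x y x' y' : Fin I.1.n} (h : I.1.graph.Adj x y)
    (h' : I.1.graph.Adj x' y') (hx : partOf I x = partOf I x') (hy : partOf I y = partOf I y') :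
    I.1.toWeightedGraph.weight ⟨s(x, y), (SimpleGraph.mem_edgeSet I.1.graph).2 h⟩ =
      I.1.toWeightedGraph.weight ⟨s(x', y'), (SimpleGraph.mem_edgeSet I.1.graph).2 h'⟩ :=
  (Classical.choose_spec I.2).2 x y x' y' h h' (by simpa [partOf] using hx)
    (by simpa [partOf] using hy)

theorem entryAt_iff_partOf :
    ∀ x < I.1.n, ∀ y < I.1.n, (entryAt I x y).1 = true ↔ partOf I x ≠ partOf I y := by
  intro x hx y hy
  have := entryAt_coe I ⟨x, hx⟩ ⟨y, hy⟩
  simp only at this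
  rw [this, entry_fst]
  exact adj_iff_partOf I ⟨x, hx⟩ ⟨y, hy⟩

theorem classOf_lt (x : Fin I.1.n) : classOf I x < k := classIndex_lt (entryAt_iff_partOf I) x.2

theorem classOf_eq_iff (x y : Fin I.1.n) : classOf I x = classOf I y ↔ partOf I x = partOf I y :=
  classIndex_eq_iff (entryAt_iff_partOf I) x.2 y.2

theorem commonDen_pos : 0 < commonDen I :=
  Finset.prod_pos fun x hx => Finset.prod_pos fun y hy => by
    have := entryAt_coe I ⟨x, Finset.mem_range.1 hx⟩ ⟨y, Finset.mem_range.1 hy⟩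
    simp only at this
    rw [this]
    exact entry_den_pos I _ _

/-- The two products differ in the single factor at `(x, y)`, which is a numerator in one and a
denominator in the other. -/
theorem scaledWeight_mul_den (x y : Fin I.1.n) :
    scaledWeight I x y * (entryAt I x y).2.2 = (entryAt I x y).2.1 * commonDen I := by
  classical
  unfold scaledWeight commonDen
  rw [← Finset.prod_product', ← Finset.prod_product']
  have hmem : ((x : ℕ), (y : ℕ)) ∈ Finset.range I.1.n ×ˢ Finset.range I.1.n := by simp
  rw [← Finset.mul_prod_erase _ _ hmem, ← Finset.mul_prod_erase _ (fun z => (entryAt I z.1 z.2).2.2) hmem]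
  have : ∏ z ∈ (Finset.range I.1.n ×ˢ Finset.range I.1.n).erase ((x : ℕ), (y : ℕ)),
      (if z.1 = x ∧ z.2 = y then (entryAt I z.1 z.2).2.1 else (entryAt I z.1 z.2).2.2) =
      ∏ z ∈ (Finset.range I.1.n ×ˢ Finset.range I.1.n).erase ((x : ℕ), (y : ℕ)),
        (entryAt I z.1 z.2).2.2 := by
    refine Finset.prod_congr rfl fun z hz => if_neg fun h => ?_
    exact (Finset.mem_erase.1 hz).1 (Prod.ext h.1 h.2)
  rw [this]
  simp
  ring

theorem weight_mul_commonDen {x y : Fin I.1.n} (h : I.1.graph.Adj x y) :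
    I.1.toWeightedGraph.weight ⟨s(x, y), (SimpleGraph.mem_edgeSet I.1.graph).2 h⟩ *
      (commonDen I : ℝ≥0) = scaledWeight I x y := by
  have h1 := scaledWeight_mul_den I x y
  have hpos := entry_den_pos I x y
  rw [entryAt_coe] at h1
  set q := I.1.weight ⟨s(x, y), (SimpleGraph.mem_edgeSet I.1.graph).2 h⟩ with hq
  have hw : I.1.toWeightedGraph.weight ⟨s(x, y), (SimpleGraph.mem_edgeSet I.1.graph).2 h⟩ =
      (q.num : ℝ≥0) / q.den := NNRat.cast_def q
  have he : entry I.1 x y = (true, q.num, q.den) := by simp [entry, h, hq]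
  rw [he] at h1 hpos
  simp only at h1 hpos
  rw [hw, div_mul_eq_mul_div, div_eq_iff (by exact_mod_cast hpos.ne')]
  exact_mod_cast h1.symm

/-- A non-edge is entered as the fraction 0/1. -/
theorem scaledWeight_eq_zero {x y : Fin I.1.n} (h : ¬ I.1.graph.Adj x y) :
    scaledWeight I x y = 0 := by
  have h1 := scaledWeight_mul_den I x y
  rw [entryAt_coe] at h1
  simpa [entry, h] using h1

theorem scaledWeight_congr {x y x' y' : Fin I.1.n} (hx : classOf I x = classOf I x')
    (hy : classOf I y = classOf I y') : scaledWeight I x y = scaledWeight I x' y' := by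
  rw [classOf_eq_iff] at hx hy
  have hadj : I.1.graph.Adj x y ↔ I.1.graph.Adj x' y' := by
    rw [adj_iff_partOf, adj_iff_partOf, hx, hy]
  by_cases h : I.1.graph.Adj x y
  · have e1 := weight_mul_commonDen I h
    have e2 := weight_mul_commonDen I (hadj.1 h)
    rw [weight_eq_of_partOf I h (hadj.1 h) hx hy, e2] at e1
    exact_mod_cast e1.symm
  · rw [scaledWeight_eq_zero I h, scaledWeight_eq_zero I (fun h' => h (hadj.2 h'))]

/-- The maximum runs over equal values, by `scaledWeight_congr`, and serves only to look up one of
them. -/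
theorem classWeight_classOf (x y : Fin I.1.n) :
    classWeight I (classOf I x) (classOf I y) = scaledWeight I x y := by
  apply le_antisymm
  · refine Finset.sup_le fun x' hx' => Finset.sup_le fun y' hy' => ?_
    split_ifs with h
    · exact (scaledWeight_congr I (x := ⟨x', Finset.mem_range.1 hx'⟩)
        (y := ⟨y', Finset.mem_range.1 hy'⟩) h.1 h.2).le
    · exact Nat.zero_le _
  · refine le_trans ?_ (Finset.le_sup (b := (x : ℕ)) (by simp))
    refine le_trans ?_ (Finset.le_sup (b := (y : ℕ)) (by simp))
    simp

/-- The class of a vertex. -/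
noncomputable def classFin (x : Fin I.1.n) : Fin k := ⟨classOf I x, classOf_lt I x⟩

theorem isScaled : IsScaled I.1.toWeightedGraph (classFin I)
    (fun i j => classWeight I i j) (commonDen I) where
  adj_iff x y := by
    rw [Ne, Fin.ext_iff]
    exact (adj_iff_partOf I x y).trans (classOf_eq_iff I x y).symm.not
  weight_mul x y h := by
    rw [show classWeight I (classFin I x) (classFin I y) = _ from classWeight_classOf I x y]
    exact weight_mul_commonDen I h
  weight_self i := by
    refine Nat.eq_zero_of_le_zero (Finset.sup_le fun x hx => Finset.sup_le fun y hy => ?_)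
    split_ifs with h
    · refine (scaledWeight_eq_zero I (x := ⟨x, Finset.mem_range.1 hx⟩)
        (y := ⟨y, Finset.mem_range.1 hy⟩) ?_).le
      rw [adj_iff_partOf, not_not, ← classOf_eq_iff]
      exact h.1.trans h.2.symm
    · exact le_rfl
  pos := commonDen_pos I

/-- Vectors of length `k * k` are read as matrices through `finProdFinEquiv`, which sends `(i, j)`
to `j + k * i`. Infeasible vectors contribute `0` and do not affect the maximum. -/
theorem coalitionValue_isMaxWeight (s : Fin k → ℕ) (c : Fin k) (e : ℕ) (he : e ≤ 1)
    (hs : ∀ i, s i < I.1.n) :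
    IsMaxWeight (fun i j => classWeight I i j) (fun i => s i + if i = c then e else 0)
      (coalitionValue I (List.ofFn s) c e) := by
  intro B
  have hF : ∀ (y : Fin (k * k) → ℕ) (i j : Fin k),
      (List.ofFn y).getD ((j : ℕ) + k * i) 0 = y (finProdFinEquiv (i, j)) := by
    intro y i j
    rw [List.getD_eq_getElem _ _ (by simpa using (finProdFinEquiv (i, j)).2)]
    simp [finProdFinEquiv]
  have hS : ∀ i : Fin k, (List.ofFn s).getD i 0 = s i := by
    intro i
    rw [List.getD_eq_getElem _ _ (by simp)]
    simp
  rw [coalitionValue, vecSup_le_iff]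
  simp only [Finset.sum_range, hF]
  have hcond : ∀ y : Fin (k * k) → ℕ, (∀ i < k, ∑ j : Fin k,
      ((List.ofFn y).getD ((j : ℕ) + k * i) 0 + (List.ofFn y).getD (i + k * j) 0) ≤
      (List.ofFn s).getD i 0 + if i = c then e else 0) ↔
      Feasible (fun i => s i + if i = c then e else 0) fun i j => y (finProdFinEquiv (i, j)) := by
    intro y
    constructor
    · intro h i
      have := h i i.2
      simpa only [hF, hS, Fin.ext_iff] using this
    · intro h i hi
      have := h ⟨i, hi⟩
      have h1 := fun j => hF y ⟨i, hi⟩ j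
      have h2 := fun j => hF y j ⟨i, hi⟩
      have h3 := hS ⟨i, hi⟩
      simp only at h1 h2 h3
      simpa only [h1, h2, h3, Fin.ext_iff] using this
  constructor
  · intro h x hx
    -- An entry is at most the count of its class, that is, at most `n - 1` plus one for the player.
    -- Hence no feasible matrix is missed.
    have hle : ∀ i j, x i j < I.1.n + 1 := by
      intro i j
      have h1 := Finset.single_le_sum (f := fun j => x i j + x j i) (fun _ _ => Nat.zero_le _)
        (Finset.mem_univ j)
      have h2 := hx i
      have h3 := hs i
      have h4 : (if i = c then e else 0) ≤ 1 := by split_ifs <;> omega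
      simp only at h1 h2
      omega
    have := h (fun t => x (finProdFinEquiv.symm t).1 (finProdFinEquiv.symm t).2) (fun t => hle _ _)
    rw [if_pos ((hcond _).2 (by simpa only [Equiv.symm_apply_apply] using hx))] at this
    simp only [Equiv.symm_apply_apply] at this
    exact this
  · intro h y hy
    split_ifs with hc
    · exact h _ ((hcond y).1 hc)
    · exact Nat.zero_le _

theorem boundedFall_eq {n a : ℕ} (h : a ≤ n) (s : ℕ) : boundedFall n a s = fall a s := by
  rw [boundedFall, fall]
  rw [← Finset.prod_subset (Finset.range_subset_range.2 h)]
  · exact Finset.prod_congr rfl fun t ht => by simp [Finset.mem_range.1 ht]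
  · intro t _ ht
    rw [if_neg fun h => ht (Finset.mem_range.2 h.2)]

theorem classSize_eq (i : Fin k) : classSize I i =
    (Finset.univ.filter fun u => u ≠ I.1.player ∧ classFin I u = i).card := by
  classical
  rw [classSize]
  refine (Finset.card_bij (fun (u : Fin I.1.n) _ => (u : ℕ)) ?_ ?_ ?_).symm
  · intro u hu
    simpa [classFin, Fin.ext_iff] using hu
  · intro u _ u' _ h
    exact Fin.ext h
  · intro y hy
    simp only [Finset.mem_filter, Finset.mem_range] at hy
    exact ⟨⟨y, hy.1⟩, by simpa [classFin, Fin.ext_iff] using hy.2, rfl⟩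

/-- The `1` is the player. This places every argument of `boundedFall` within its range `n`. -/
theorem sum_classSize : ∑ i : Fin k, classSize I i + 1 = I.1.n := by
  classical
  have h : ∀ i : Fin k, classSize I i = classCount (classFin I) (Finset.univ.erase I.1.player) i := by
    intro i
    rw [classSize_eq, classCount]
    congr 1
    ext u
    simp
  simp only [h]
  rw [classCount_sum, Finset.card_erase_of_mem (Finset.mem_univ _), Finset.card_univ, Fintype.card_fin]
  have := I.1.player.2
  omega

theorem shapleyNum_eq : (shapleyNum I : ℝ) =
    (∏ i : Fin k, (classSize I i).factorial : ℕ) *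
      (I.1.toWeightedGraph.matchingGame.rawShapleyValue I.1.player * commonDen I) := by
  have hsum := sum_classSize I
  rw [(isScaled I).rawShapleyValue_mul I.1.player
    (fun s e => coalitionValue I (List.ofFn s) (classOf I I.1.player) e)
    (fun s e hs he => coalitionValue_isMaxWeight I s (classFin I I.1.player) e he
      (by simpa using hs)) (fun i => classSize I i) (classSize_eq I), ← Nat.cast_mul]
  congr 1
  rw [shapleyNum, vecSum_eq, Finset.mul_sum, Fintype.card_fin]
  refine Finset.sum_congr rfl fun s _ => ?_
  have hS : ∀ i : Fin k, (List.ofFn s).getD i 0 = s i := by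
    intro i
    rw [List.getD_eq_getElem _ _ (by simp)]
    simp
  have hcond : (∀ i < k, (List.ofFn s).getD i 0 ≤ classSize I i) ↔ ∀ i : Fin k, s i ≤ classSize I i :=
    ⟨fun h i => (hS i) ▸ h i i.2, fun h i hi => (hS ⟨i, hi⟩).symm ▸ h ⟨i, hi⟩⟩
  simp only [hcond, Finset.prod_range, Finset.sum_range, hS]
  split_ifs with h
  · have hle : ∑ i, s i ≤ ∑ i : Fin k, classSize I i := Finset.sum_le_sum fun i _ => h i
    have hn : ∀ i : Fin k, classSize I i ≤ I.1.n := fun i =>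
      (Finset.single_le_sum (f := fun i : Fin k => classSize I i) (fun _ _ => Nat.zero_le _)
        (Finset.mem_univ i)).trans (by omega)
    rw [boundedFall_eq (by omega), boundedFall_eq (by omega), fall_zero, fall_zero]
    have : ∀ i : Fin k, boundedFall I.1.n (classSize I i) (s i) *
        boundedFall I.1.n (classSize I i) (classSize I i - s i) =
        (classSize I i).choose (s i) * (classSize I i).factorial := fun i => by
      rw [boundedFall_eq (hn i), boundedFall_eq (hn i), fall_mul_fall (h i)]
    simp only [this, Finset.prod_mul_distrib]
    ring
  -- Counts exceeding some class contribute `0` in the program, and a vanishing binomial coefficient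
  -- in the formula.
  · push Not at h
    obtain ⟨i, hi⟩ := h
    rw [Finset.prod_eq_zero (f := fun i : Fin k => (classSize I i).choose (s i)) (Finset.mem_univ i)
      (Nat.choose_eq_zero_of_lt hi)]
    simp

theorem shapleyDen_eq : shapleyDen I =
    commonDen I * (I.1.n.factorial * ∏ i : Fin k, (classSize I i).factorial) := by
  have hsum := sum_classSize I
  have hn : ∀ i : Fin k, classSize I i ≤ I.1.n := fun i =>
    (Finset.single_le_sum (f := fun i : Fin k => classSize I i) (fun _ _ => Nat.zero_le _)
      (Finset.mem_univ i)).trans (by omega)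
  rw [shapleyDen, Finset.prod_range, boundedFall_eq le_rfl, fall_zero]
  congr 2
  exact Finset.prod_congr rfl fun i _ => by rw [boundedFall_eq (hn i), fall_zero]

theorem shapleyDen_ne_zero : shapleyDen I ≠ 0 := by
  rw [shapleyDen_eq]
  have h1 := (commonDen_pos I).ne'
  have h2 : ∏ i : Fin k, (classSize I i).factorial ≠ 0 :=
    Finset.prod_ne_zero_iff.2 fun i _ => Nat.factorial_ne_zero _
  exact mul_ne_zero h1 (mul_ne_zero (Nat.factorial_ne_zero _) h2)

theorem shapleyValue_eq :
    I.1.toWeightedGraph.matchingGame.shapleyValue I.1.player = shapleyNum I / shapleyDen I := by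
  have h0 : (shapleyDen I : ℝ) ≠ 0 := Nat.cast_ne_zero.2 (shapleyDen_ne_zero I)
  rw [eq_div_iff h0, shapleyNum_eq, shapleyDen_eq, CoopGame.shapleyValue, Fintype.card_fin]
  have : (I.1.n.factorial : ℝ) ≠ 0 := Nat.cast_ne_zero.2 (Nat.factorial_ne_zero _)
  push_cast
  field_simp

end

/-! ### Input and output of machines -/

/-- The tree with `d` inner nodes on a right spine. -/
def spine : ℕ → BTree
  | 0 => nil
  | d + 1 => node nil (spine d)

/-- The symbols in the order of their encodings. -/
def symbols : List Γ' := [.blank, .bit false, .bit true, .bra, .ket, .comma]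

theorem exists_spine (g : Γ') : ∃ d < 6, enc g = spine d ∧ symbols[d]? = some g := by
  rcases g with _ | (_ | _) | _ | _ | _
  exacts [⟨0, by simp, rfl, rfl⟩, ⟨1, by simp, rfl, rfl⟩, ⟨2, by simp, rfl, rfl⟩,
    ⟨3, by simp, rfl, rfl⟩, ⟨4, by simp, rfl, rfl⟩, ⟨5, by simp, rfl, rfl⟩]

theorem size_spine (d : ℕ) : (spine d).size = 2 * d + 1 := by
  induction d with
  | zero => rfl
  | succ d ih => simp [spine, BTree.size, ih]; omega

theorem size_enc_symbol_le (g : Γ') : (enc g).size ≤ 11 := by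
  obtain ⟨d, hd, h, -⟩ := exists_spine g
  rw [h, size_spine]; omega

theorem sz_symbols_le (l : List Γ') : sz l ≤ 12 * l.length + 1 := by
  have := sz_le_of_forall (l := l) (B := 11) fun g _ => size_enc_symbol_le g
  omega

/-- Turn the symbols on stack `3` into a list on the main stack. -/
def readLoop : Cmd := .loop 3 Option.isSome (.cases 3 fun o =>
  .seq (.pop 3) (.seq (pushList 1 (enc (o.getD .blank)).ser) (.push 1 (.bit true))))

theorem runLe_readLoop (l m : List Γ') :
    RunLe readLoop (st [] (enc m).ser [] l [] []) (17 * l.length + 1)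
      (st [] (enc (l.reverse ++ m)).ser [] [] [] []) := by
  induction l generalizing m with
  | nil => exact RunLe.loop_done rfl
  | cons g l ih =>
    have h1 := RunLe.pop 3 (st [] (enc m).ser [] (g :: l) [] [])
    have h2 := runLe_pushList_one (enc g).ser [] (enc m).ser [] l [] []
    have h3 := RunLe.push 1 (.bit true) (st [] ((enc g).ser ++ (enc m).ser) [] l [] [])
    have h4 := ih (g :: m)
    have h5 := size_enc_symbol_le g
    simp at h1 h2 h3
    refine ((RunLe.loop_step rfl (RunLe.cases (h1.seq (h2.seq h3))) (h4.congr_left ?_)).mono ?_).congr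
      ?_
    · simp [ser]
    · simp; omega
    · simp

/-- Read a symbol from the main stack onto stack `3`. -/
def decodeSymbol : List Γ' → Cmd
  | [] => .pop 1
  | g :: l => .cases 1 fun o => bif isOne o then .seq (.pop 1) (.seq (.pop 1) (decodeSymbol l))
    else .seq (.pop 1) (.push 3 g)

theorem runLe_decodeSymbol (d : ℕ) (l : List Γ') (g : Γ') (h : l[d]? = some g) (i R L A : List Γ') :
    RunLe (decodeSymbol l) (st i ((spine d).ser ++ R) L A [] []) (3 * d + 3)
      (st i R L (g :: A) [] []) := by
  induction d generalizing l with
  | zero =>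
    cases l with
    | nil => simp at h
    | cons a l =>
      simp at h
      subst h
      exact (RunLe.cases (((RunLe.pop 1 _).seq (RunLe.push 3 a _)).congr (by simp [ser, spine]))).mono
        (by omega)
  | succ d ih =>
    cases l with
    | nil => simp at h
    | cons a l =>
      exact (RunLe.cases ((RunLe.pop 1 _).seq ((RunLe.pop 1 _).seq
        ((ih l (by simpa using h)).congr_left (by simp [ser, spine]))))).mono (by omega)

/-- Turn the list on the main stack into symbols on stack `3`. -/
def writeLoop : Cmd := .loop 1 isOne (.seq (.pop 1) (decodeSymbol symbols))

theorem runLe_writeLoop (l A : List Γ') :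
    RunLe writeLoop (st [] (enc l).ser [] A [] []) (20 * l.length + 1)
      (st [] nil.ser [] (l.reverse ++ A) [] []) := by
  induction l generalizing A with
  | nil => exact RunLe.loop_done rfl
  | cons g l ih =>
    obtain ⟨d, hd, he, hg⟩ := exists_spine g
    have h1 := RunLe.pop 1 (st [] (enc (g :: l)).ser [] A [] [])
    have h2 := runLe_decodeSymbol d symbols g hg [] (enc l).ser [] A
    simp [ser, he] at h1
    refine (((RunLe.loop_step rfl (h1.seq h2) (ih (g :: A))).mono ?_).congr_left ?_).congr ?_
    · simp; omega
    · simp [ser, he]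
    · simp

/-- A polynomial-time function on trees between types whose elements are written as lists of
symbols is computed by a polynomial-time machine. -/
theorem PolyTime.nonempty_computable {α β : Type} [Enc α] {ea : α → List Γ'} {eb : β → List Γ'}
    (hea : ∀ a, enc a = enc (ea a)) {f : α → β} (hf : PolyTime fun a => eb (f a)) :
    Nonempty (Turing.TM2ComputableInPolyTime ea eb f) := by
  have hsz := hf.sz_bd
  obtain ⟨c, b, ⟨P, hP⟩, hc⟩ := hf
  obtain ⟨Q, hQ⟩ := hsz
  refine nonempty_computableInPolyTime
    (.seq (moveAll 0 3) (.seq (.push 1 (.bit false)) (.seq readLoop (.seq c (.seq writeLoop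
      (.seq (.pop 1) (moveAll 3 0)))))))
    -- The tree of a word of length `X` has size at most `12 * X + 1`. `P` bounds the time of `c`,
    -- `Q` the length of the output, and the linear terms account for moving, reading and writing.
    (21 * Polynomial.X + 9 + P.comp (12 * Polynomial.X + 1) +
      24 * Q.comp (12 * Polynomial.X + 1)) fun a => ?_
  have hs : sz a ≤ 12 * (ea a).length + 1 := by
    have := sz_symbols_le (ea a)
    rwa [sz, ← hea] at this
  have hb : b a ≤ P.eval (12 * (ea a).length + 1) := (hP a).trans (eval_mono P hs)
  have ho : (eb (f a)).length ≤ Q.eval (12 * (ea a).length + 1) :=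
    (length_lt_sz _).le.trans ((hQ a).trans (eval_mono Q hs))
  have h1 := runLe_moveAll (j := 0) (k := 3) (by decide) (st (ea a) [] [] [] [] [])
  have h2 := RunLe.push 1 (.bit false) (st [] [] [] (ea a).reverse [] [])
  have h3 := runLe_readLoop (ea a).reverse []
  have h4 := hc a [] [] []
  have h5 := runLe_writeLoop (eb (f a)) []
  have h6 := RunLe.pop 1 (st [] nil.ser [] (eb (f a)).reverse [] [])
  have h7 := runLe_moveAll (j := 3) (k := 0) (by decide) (st [] [] [] (eb (f a)).reverse [] [])
  simp [ser, hea] at h1 h2 h3 h4 h5 h6 h7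
  refine (h1.seq (h2.seq (h3.seq (h4.seq (h5.seq (h6.seq h7)))))).mono ?_
  simp
  omega

theorem PolyTime.encodeFraction {α : Type} [Enc α] {f : α → ℕ × ℕ} (hf : PolyTime f) :
    PolyTime fun a => ShapleyMatching.encodeFraction (f a) := by
  have hbit : PolyTime fun b : Bool => Γ'.bit b :=
    (PolyTime.cond (α := Bool) PolyTime.id (.const (Γ'.bit true)) (.const (Γ'.bit false))).congr_enc
      fun b => by cases b <;> rfl
  have h1 := hf.fst.bits
  have h2 := hf.snd.bits
  simp only [ShapleyMatching.encodeFraction, encodeNat, encodeNat_eq_bits]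
  exact ((h1.map (h := fun _ b => Γ'.bit b) (by fun_prop)).append (.const _)).append
    (h2.map (h := fun _ b => Γ'.bit b) (by fun_prop))

end ShapleyMatching

/-! ### The main theorem -/

theorem mainTheorem6 (k : ℕ) :
    ∃ f : ShapleyMatching.KPartiteInstance k → ℕ × ℕ,
      Nonempty (Turing.TM2ComputableInPolyTime
        (fun I : ShapleyMatching.KPartiteInstance k => ShapleyMatching.encodeInstance I.1)
        ShapleyMatching.encodeFraction f) ∧
      ∀ I : ShapleyMatching.KPartiteInstance k,
        (f I).2 ≠ 0 ∧
          I.1.toWeightedGraph.matchingGame.shapleyValue I.1.player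
            = ((f I).1 : ℝ) / ((f I).2 : ℝ) := by
  refine ⟨fun I => (ShapleyMatching.shapleyNum I, ShapleyMatching.shapleyDen I), ?_, fun I =>
    ⟨ShapleyMatching.shapleyDen_ne_zero I, ShapleyMatching.shapleyValue_eq I⟩⟩
  exact ShapleyMatching.PolyTime.nonempty_computable
    (ea := fun I : ShapleyMatching.KPartiteInstance k => ShapleyMatching.encodeInstance I.1)
    (fun _ => rfl)
    (ShapleyMatching.PolyTime.encodeFraction
      (f := fun I => (ShapleyMatching.shapleyNum I, ShapleyMatching.shapleyDen I))
      (ShapleyMatching.PolyTime.shapleyNum.prodMk ShapleyMatching.PolyTime.shapleyDen))
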